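/- Let $d,p\ge 1$ be integers and let $f:(\mathbb{R}^d)^p\to[0,\infty)$ be a symmetric measurable function. For a finite set $Y\subset\mathbb{R}^d$ put $F(Y)=\sum_{S\subset Y,\,|S|=p}f(S)$, where $f(\{x_1,\dots,x_p\}):=f(x_1,\dots,x_p)$. Let $K:\mathbb{R}^d\times\mathbb{R}^d\to\mathbb{C}$ be a bounded kernel satisfying Condition $\mathcal{H}$: $K$ is measurable, hermitian and locally square integrable, and its integral operator $\mathcal{K}$, $\mathcal{K}g(x)=\int K(x,y)g(y)\,dy$, is locally of trace class with eigenvalues in $[0,1]$ (i.e. for every compact $C$ the integral operator with kernel $K$ on $L^2(C)$ is of trace class with all its eigenvalues in $[0,1]$). Assume that the operator norm of $\mathcal{K}$ on $L^2(\mathbb{R}^d)$ satisfies $\|\mathcal{K}\|<1$. Let $X$ be a determinantal point process on $\mathbb{R}^d$ with kernel $K$, i.e. a locally finite simple point process whose intensity functions of all orders $n\geq 1$ with respect to Lebesgue measure are $\rho_n(x)=\det K[x]$, where $K[x]=(K(x_i,x_j))_{1\le i,j\le n}$. Let $(W_n)$ be an increasing sequence of compact subsets of $\mathbb{R}^d$,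 and let $|W_n|$ be the volume of $W_n$. If $$\liminf_{n\to\infty}\frac{1}{|W_n|}\int_{W_n^p}f(x)\det(K[x])\,dx>0,$$ then $$\liminf_{n\to\infty}\frac{1}{|W_n|}\operatorname{Var}\bigl(F(X\cap W_n)\bigr)>0 .$$ Here the integrals and variances take values in $[0,\infty]$; the variance is $+\infty$ when $F(X\cap W_n)$ is not square integrable, and the quotients are read as $0$ when numerator and denominator both vanish. -/

import Mathlib

open MeasureTheory Filter Topology
open scoped ENNReal

/-- The Euclidean space `ℝ^d`. -/
abbrev Euc (d : ℕ) : Type := EuclideanSpace ℝ (Fin d)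

/-! ### Point processes -/

/-- Locally finite simple point configurations in `ℝ^d`. -/
structure PointConfig (d : ℕ) where
  carrier : Set (Euc d)
  finite_inter : ∀ B : Set (Euc d), Bornology.IsBounded B → (carrier ∩ B).Finite

/-- The σ-algebra on configurations generated by the events `N(B) = m`, where `N(B)` is the
number of points in the Borel set `B`. -/
instance PointConfig.measurableSpace (d : ℕ) : MeasurableSpace (PointConfig d) :=
  MeasurableSpace.generateFrom
    {A | ∃ B : Set (Euc d), MeasurableSet B ∧ ∃ m : ℕ,
      A = {s : PointConfig d | (s.carrier ∩ B).encard = m}}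

/-- `ρ` is an `n`-th order intensity function of the point process `X`, with respect to Lebesgue
measure: a non-negative measurable function (defined up to a null set) such that, for all
non-negative measurable `g`, the expectation of the sum of `g(x₁, …, xₙ)` over the ordered
`n`-tuples of pairwise distinct points of `X` is the integral of `g ρ`. -/
def IsIntensity {Ω : Type*} [MeasurableSpace Ω] (P : Measure Ω) {d : ℕ}
    (X : Ω → PointConfig d) (n : ℕ) (ρ : (Fin n → Euc d) → ℝ) : Prop :=
  Measurable ρ ∧ (∀ᵐ x, 0 ≤ ρ x) ∧
    ∀ g : (Fin n → Euc d) → ℝ≥0∞, Measurable g →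
      ∫⁻ ω, (∑' x : {x : Fin n → Euc d //
          Function.Injective x ∧ ∀ i, x i ∈ (X ω).carrier}, g x.1) ∂P
        = ∫⁻ x, g x * ENNReal.ofReal (ρ x)

/-- The matrix `K[x] = (K(x_i, x_j))_{i,j}`. -/
def kernelMatrix {d : ℕ} (K : Euc d → Euc d → ℂ) {n : ℕ} (x : Fin n → Euc d) :
    Matrix (Fin n) (Fin n) ℂ :=
  Matrix.of fun i j => K (x i) (x j)

/-- `X` is a determinantal point process with kernel `K`: a measurable random configuration
whose intensity functions of all orders `n ≥ 1` are `ρ_n(x) = det K[x]`. -/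
def IsDPP {Ω : Type*} [MeasurableSpace Ω] (P : Measure Ω) {d : ℕ}
    (X : Ω → PointConfig d) (K : Euc d → Euc d → ℂ) : Prop :=
  Measurable X ∧ ∀ n : ℕ, 1 ≤ n → ∃ ρ : (Fin n → Euc d) → ℝ,
    IsIntensity P X n ρ ∧ ∀ x, (ρ x : ℂ) = (kernelMatrix K x).det

/-! ### Integral operators -/

/-- The integral operator with kernel `K` applied to the function `g`. -/
noncomputable def kernelApply {d : ℕ} (μ : Measure (Euc d)) (K : Euc d → Euc d → ℂ)
    (g : Euc d → ℂ) (x : Euc d) : ℂ :=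
  ∫ y, K x y * g y ∂μ

/-- The bounded operator `T` on `L²(μ)` is the integral operator with kernel `K`. -/
def IsIntegralOperator {d : ℕ} (μ : Measure (Euc d)) (K : Euc d → Euc d → ℂ)
    (T : Lp ℂ 2 μ →L[ℂ] Lp ℂ 2 μ) : Prop :=
  ∀ g : Lp ℂ 2 μ, (T g : Euc d → ℂ) =ᵐ[μ] kernelApply μ K g

/-- The operator norm of the integral operator with kernel `K` on `L²(ℝ^d)`, i.e. the supremum
of `‖𝒦 g‖₂` over `‖g‖₂ ≤ 1`. It is an extended number, infinite for an unbounded operator. -/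
noncomputable def kernelOpNorm {d : ℕ} (K : Euc d → Euc d → ℂ) : ℝ≥0∞ :=
  ⨆ (g : Euc d → ℂ) (_ : MemLp g 2 volume) (_ : eLpNorm g 2 volume ≤ 1),
    eLpNorm (kernelApply volume K g) 2 volume

/-- A bounded operator `T` on a Hilbert space is of trace class if `∑ ⟨e_i, |T| e_i⟩ < ∞` for
some (equivalently, every) Hilbert basis `(e_i)`, where `|T| = (T* T)^{1/2}`. -/
def IsTraceClassOp {H : Type*} [NormedAddCommGroup H] [InnerProductSpace ℂ H] [CompleteSpace H]
    (T : H →L[ℂ] H) : Prop :=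
  ∃ (w : Set H) (e : HilbertBasis w ℂ H),
    Summable fun i : w => (inner ℂ (e i) (CFC.abs T (e i))).re

/-- Condition `ℋ`: `K` is a measurable, hermitian, locally square integrable kernel whose
integral operator is locally (that is, on `L²(C)` for every compact set `C`) of trace class with
eigenvalues in `[0, 1]`. -/
structure ConditionH {d : ℕ} (K : Euc d → Euc d → ℂ) : Prop where
  measurable : Measurable fun z : Euc d × Euc d => K z.1 z.2
  hermitian : ∀ x y, K y x = star (K x y)
  locally_sq_integrable : ∀ C : Set (Euc d), IsCompact C →
    IntegrableOn (fun z : Euc d × Euc d => ‖K z.1 z.2‖ ^ 2) (C ×ˢ C)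
  locally_traceClass : ∀ C : Set (Euc d), IsCompact C →
    ∃ T : Lp ℂ 2 (volume.restrict C) →L[ℂ] Lp ℂ 2 (volume.restrict C),
      IsIntegralOperator (volume.restrict C) K T ∧ IsTraceClassOp T ∧
      ∀ z : ℂ, Module.End.HasEigenvalue
          (T : Lp ℂ 2 (volume.restrict C) →ₗ[ℂ] Lp ℂ 2 (volume.restrict C)) z →
        z.im = 0 ∧ 0 ≤ z.re ∧ z.re ≤ 1

/-! ### Sums over subsets with `p` elements -/

/-- `∑_{S ⊆ s, |S| = p} f(S)`, where `f(S)` is the value of `f` at an enumeration of `S` (which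
one does not matter for symmetric `f`). It is used for finite `s`, where the sum is finite. -/
noncomputable def subsetSum {d p : ℕ} (f : (Fin p → Euc d) → ℝ) (s : Set (Euc d)) : ℝ :=
  ∑' S : {S : Finset (Euc d) // (S : Set (Euc d)) ⊆ s ∧ S.card = p},
    f fun i => ((S.1.equivFinOfCardEq S.2.2).symm i : Euc d)

/-! Let `N` be the number of points in `W`, `U` the sum of `f` over ordered `p`-tuples of distinct
points of `X ∩ W` (so `U = p! F`), and `a = E U`. By Cauchy–Schwarz, `Var U ≥ Cov(U, N)² / Var N`.
Two-point intensities are at most products of one-point intensities, so `Var N ≤ E N ≤ M |W|`. It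
remains to bound `Cov(U, N)` below by a multiple of `a`.

A point counted by `N` is either one of the `p` entries of the tuple, which contributes `p a` to
`E(U N)`, or a further point `y`, which contributes the integral of `f(x) det K[y, x]`. By the Schur
complement, `∫_W det K[y, x] dy = det K[x] (E N - tr(K[x]⁻¹ B))` with `B_ij = ∫_W K(x_i, z) K(z,
x_j) dz`. The bound `‖𝒦‖ ≤ κ < 1` gives `B ≤ κ K[x]`, so the trace is at most `κ p` and `Cov(U, N) ≥
p (1 - κ) a`. As `a` is eventually at least `ε |W|`, `Var F` is at least a constant times `|W|`.

The matrix inequality is needed for almost every `x`, while values of `K` matter only up to null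
sets. It is derived from the positivity of `K[x, z]` for random samples `z` in `W` and the law of
large numbers (`posSemidef_smul_kernelMatrix_sub`). The other main steps are `det_mul_lintegral_le`,
`tupleSum_mul_encard` and `sq_mul_sq_le_evariance_mul`. -/

open scoped ComplexOrder MatrixOrder

/-! ### Positive semidefiniteness from principal minors, and a trace bound. -/

namespace Matrix

/-- The determinant is affine in each diagonal entry. -/
theorem det_add_diagonal_single {n : ℕ} (A : Matrix (Fin (n + 1)) (Fin (n + 1)) ℂ)
    (a : Fin (n + 1)) (t : ℂ) :
    (A + diagonal (Pi.single a t)).det = A.det + t * (A.submatrix a.succAbove a.succAbove).det := by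
  have h1 : A + diagonal (Pi.single a t) = A.updateRow a (A a + t • Pi.single a 1) := by
    ext i j
    by_cases hi : i = a
    · subst hi
      by_cases hj : j = i
      · subst hj; simp
      · simp [hj, Ne.symm hj]
    · simp [diagonal_apply, hi]
  have h2 : (A.updateRow a (Pi.single a 1)).det = A.adjugate a a := (adjugate_apply A a a).symm
  rw [h1, det_updateRow_add, det_updateRow_smul, updateRow_eq_self, h2,
    adjugate_fin_succ_eq_det_submatrix, Even.neg_one_pow ⟨_, rfl⟩, one_mul]

/-- If all principal minors of `A` are nonnegative, then adding a nonnegative (positive) diagonal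
matrix gives a nonnegative (positive) determinant. -/
theorem det_add_diagonal_nonneg_and_pos {n : ℕ} (A : Matrix (Fin n) (Fin n) ℂ)
    (hA : ∀ (k : ℕ) (e : Fin k → Fin n), Function.Injective e → 0 ≤ (A.submatrix e e).det)
    (d : Fin n → ℝ) :
    ((∀ i, 0 ≤ d i) → 0 ≤ (A + diagonal fun i => (d i : ℂ)).det) ∧
      ((∀ i, 0 < d i) → 0 < (A + diagonal fun i => (d i : ℂ)).det) := by
  induction n with
  | zero => simp
  | succ n ih =>
    have sub (a : Fin (n + 1)) (d : Fin (n + 1) → ℝ) :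
        (A + diagonal fun i => (d i : ℂ)).submatrix a.succAbove a.succAbove
          = A.submatrix a.succAbove a.succAbove
            + diagonal fun i => ((d (a.succAbove i) : ℝ) : ℂ) := by
      ext i j
      simp [diagonal_apply]
    have minors (a : Fin (n + 1)) (k : ℕ) (e : Fin k → Fin n) (he : Function.Injective e) :
        0 ≤ ((A.submatrix a.succAbove a.succAbove).submatrix e e).det := by
      rw [submatrix_submatrix]
      exact hA k _ (Fin.succAbove_right_injective.comp he)
    have split (a : Fin (n + 1)) (d : Fin (n + 1) → ℝ) :
        (A + diagonal fun i => (d i : ℂ)).det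
          = (A + diagonal fun i => ((Function.update d a 0 i : ℝ) : ℂ)).det
            + d a * (A.submatrix a.succAbove a.succAbove
                + diagonal fun i => ((d (a.succAbove i) : ℝ) : ℂ)).det := by
      have h1 : (A + diagonal fun i => (d i : ℂ))
          = (A + diagonal fun i => ((Function.update d a 0 i : ℝ) : ℂ))
            + diagonal (Pi.single a (d a : ℂ)) := by
        rw [add_assoc, diagonal_add]
        congr 2
        ext i
        by_cases hi : i = a
        · subst hi; simp
        · simp [hi]
      rw [h1, det_add_diagonal_single, sub]
      simp [Fin.succAbove_ne]
    -- Induction on the support of the diagonal: splitting off one entry leaves a smaller support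
    -- and a minor covered by `ih`.
    have nonneg (s : Finset (Fin (n + 1))) : ∀ d : Fin (n + 1) → ℝ, (∀ i, 0 ≤ d i) →
        (∀ i ∉ s, d i = 0) → 0 ≤ (A + diagonal fun i => (d i : ℂ)).det := by
      induction s using Finset.induction_on with
      | empty =>
        intro d _ hs
        have : (fun i => (d i : ℂ)) = 0 := by ext i; simp [hs i]
        rw [this]
        simpa using hA (n + 1) id Function.injective_id
      | insert a s ha ihs =>
        intro d hd hs
        rw [split a d]
        refine add_nonneg (ihs _ (fun i => ?_) fun i hi => ?_) (mul_nonneg ?_ ?_)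
        · by_cases h : i = a
          · subst h; simp
          · simp [h, hd]
        · by_cases h : i = a
          · subst h; simp
          · simp [h, hs i (by simp [h, hi])]
        · exact_mod_cast hd a
        · exact (ih _ (minors a) _).1 fun i => hd _
    refine ⟨fun hd => nonneg Finset.univ d hd (by simp), fun hd => ?_⟩
    -- Strictness comes from the second term alone: `d 0 > 0` times a smaller determinant, down to
    -- the empty determinant `1`.
    rw [split 0 d]
    refine add_pos_of_nonneg_of_pos (nonneg Finset.univ _ (fun i => ?_) (by simp)) (mul_pos ?_ ?_)
    · by_cases h : i = 0
      · subst h; simp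
      · simp [h, (hd i).le]
    · exact_mod_cast hd 0
    · exact (ih _ (minors 0) _).2 fun i => hd _

/-- A Hermitian matrix with nonnegative principal minors is positive semidefinite. -/
theorem IsHermitian.posSemidef_of_fin_minors {n : ℕ} {A : Matrix (Fin n) (Fin n) ℂ}
    (hA : A.IsHermitian)
    (h : ∀ (k : ℕ) (e : Fin k → Fin n), Function.Injective e → 0 ≤ (A.submatrix e e).det) :
    A.PosSemidef := by
  rw [hA.posSemidef_iff_eigenvalues_nonneg]
  intro i
  by_contra! hi
  have hi : hA.eigenvalues i < 0 := hi
  -- For a negative eigenvalue `λ`, the matrix `A - λ I` would have positive determinant, yet the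
  -- eigenvector lies in its kernel.
  have hpos := (det_add_diagonal_nonneg_and_pos A h fun _ => -hA.eigenvalues i).2
    fun _ => by linarith
  refine hpos.ne' ?_
  rw [← exists_mulVec_eq_zero_iff]
  refine ⟨(hA.eigenvectorBasis i).ofLp, ?_, ?_⟩
  · intro h0
    exact hA.eigenvectorBasis.toBasis.ne_zero i (by ext j; simpa using congrFun h0 j)
  · rw [add_mulVec, hA.mulVec_eigenvectorBasis i]
    ext j
    simp

theorem IsHermitian.posSemidef_of_minors {ι : Type*} [Fintype ι] {A : Matrix ι ι ℂ}
    (hA : A.IsHermitian)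
    (h : ∀ (k : ℕ) (e : Fin k → ι), Function.Injective e → 0 ≤ (A.submatrix e e).det) :
    A.PosSemidef := by
  rw [← posSemidef_submatrix_equiv (Fintype.equivFin ι).symm]
  refine (hA.submatrix _).posSemidef_of_fin_minors fun k e he => ?_
  rw [submatrix_submatrix]
  exact h k _ ((Fintype.equivFin ι).symm.injective.comp he)

theorem PosSemidef.trace_mul_nonneg {n : Type*} [Fintype n] [DecidableEq n]
    {A B : Matrix n n ℂ} (hA : A.PosSemidef) (hB : B.PosSemidef) : 0 ≤ (A * B).trace := by
  obtain ⟨R, rfl⟩ := CStarAlgebra.nonneg_iff_eq_star_mul_self.1 hA.nonneg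
  rw [mul_assoc, trace_mul_comm]
  exact (hB.mul_mul_conjTranspose_same R).trace_nonneg

/-- If `B ≤ κ A` with `A` positive definite, then `tr (A⁻¹ B) ≤ κ n`. -/
theorem PosDef.trace_inv_mul_le {n : Type*} [Fintype n] [DecidableEq n]
    {A B : Matrix n n ℂ} (hA : A.PosDef) {κ : ℝ} (hB : ((κ : ℂ) • A - B).PosSemidef) :
    (A⁻¹ * B).trace.re ≤ κ * Fintype.card n := by
  have h := PosSemidef.trace_mul_nonneg hA.inv.posSemidef hB
  rw [mul_sub, Algebra.mul_smul_comm, nonsing_inv_mul _ ((isUnit_iff_isUnit_det _).1 hA.isUnit), trace_sub,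
    trace_smul, trace_one] at h
  have := (Complex.le_def.1 h).1
  simpa using this

end Matrix

/-! ### Almost everywhere positivity of the kernel matrices. -/

/-- Selecting distinct coordinates is quasi-measure-preserving. -/
theorem quasiMeasurePreserving_comp_injective {ι κ E : Type*} [Fintype ι] [Fintype κ]
    [MeasureSpace E] [SigmaFinite (volume : Measure E)] {e : κ → ι} (he : Function.Injective e) :
    Measure.QuasiMeasurePreserving (fun x : ι → E => x ∘ e) := by
  classical
  obtain ⟨q, φ, hφ⟩ : ∃ (q : ι → Prop) (φ : {i // q i} ≃ κ), ∀ k, (φ.symm k).1 = e k :=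
    ⟨(· ∈ Set.range e), (Equiv.ofInjective e he).symm, fun _ => rfl⟩
  have h1 := (volume_preserving_piEquivPiSubtypeProd (fun _ : ι => E) q).quasiMeasurePreserving
  have h2 : Measure.QuasiMeasurePreserving
      (Prod.fst : ({i // q i} → E) × ({i // ¬ q i} → E) → _) :=
    Measure.quasiMeasurePreserving_fst
  have h3 := (volume_measurePreserving_piCongrLeft (fun _ : κ => E) φ).quasiMeasurePreserving
  convert! h3.comp (h2.comp h1) using 1
  ext x k
  obtain ⟨j, rfl⟩ := φ.surjective k
  simp only [Function.comp_apply, MeasurableEquiv.coe_piCongrLeft, Equiv.piCongrLeft_apply_apply]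
  simp [MeasurableEquiv.piEquivPiSubtypeProd, Equiv.piEquivPiSubtypeProd, ← hφ]

section Kernel

variable {d : ℕ} {K : Euc d → Euc d → ℂ}

theorem IsDPP.ae_det_nonneg {Ω : Type*} [MeasurableSpace Ω] {P : Measure Ω}
    {X : Ω → PointConfig d} (hX : IsDPP P X K) (n : ℕ) :
    ∀ᵐ x : Fin n → Euc d, 0 ≤ (kernelMatrix K x).det := by
  rcases Nat.eq_zero_or_pos n with rfl | hn
  · exact .of_forall fun x => by simp
  obtain ⟨ρ, ⟨-, hρ, -⟩, h⟩ := hX.2 n hn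
  filter_upwards [hρ] with x hx
  rw [← h x]
  exact_mod_cast hx

/-- If all intensities `det K[x]` are nonnegative, the matrices `K[x]` are almost everywhere
positive semidefinite. -/
theorem ae_posSemidef_of_ae_det_nonneg (hK : ∀ x y, K y x = star (K x y))
    (h : ∀ n, ∀ᵐ x : Fin n → Euc d, 0 ≤ (kernelMatrix K x).det) (ι : Type*) [Fintype ι] :
    ∀ᵐ x : ι → Euc d, (Matrix.of fun i j => K (x i) (x j)).PosSemidef := by
  -- There are only countably many selections of coordinates, so one null set serves all principal
  -- minors.
  have h1 : ∀ᵐ x : ι → Euc d, ∀ (k : ℕ) (e : Fin k ↪ ι),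
      0 ≤ (kernelMatrix K (x ∘ e)).det := by
    rw [ae_all_iff]
    intro k
    rw [ae_all_iff]
    exact fun e => (quasiMeasurePreserving_comp_injective e.injective).ae (h k)
  filter_upwards [h1] with x hx
  refine Matrix.IsHermitian.posSemidef_of_minors ?_ fun k e he => hx k ⟨e, he⟩
  ext i j
  simp [hK (x i) (x j)]

/-- For almost every `x`, the matrices `K[x, z]` are positive semidefinite for almost every `z`. -/
theorem ae_ae_posSemidef (hK : ∀ x y, K y x = star (K x y))
    (h : ∀ n, ∀ᵐ x : Fin n → Euc d, 0 ≤ (kernelMatrix K x).det) (p : ℕ) :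
    ∀ᵐ x : Fin p → Euc d, ∀ n : ℕ, ∀ᵐ z : Fin n → Euc d,
      (Matrix.of fun i j : Fin p ⊕ Fin n => K (Sum.elim x z i) (Sum.elim x z j)).PosSemidef := by
  rw [ae_all_iff]
  intro n
  have h1 := (volume_measurePreserving_sumPiEquivProdPi_symm
    (fun _ : Fin p ⊕ Fin n => Euc d)).quasiMeasurePreserving.ae
      (ae_posSemidef_of_ae_det_nonneg hK h _)
  have h2 := Measure.ae_ae_of_ae_prod h1
  filter_upwards [h2] with x hx
  filter_upwards [hx] with z hz
  have hxz : (MeasurableEquiv.sumPiEquivProdPi fun _ : Fin p ⊕ Fin n => Euc d).symm (x, z)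
      = Sum.elim x z := by
    ext1 i
    cases i <;> rfl
  rwa [hxz] at hz

/-! ### From empirical averages to integrals. -/

theorem integral_eval_pair {E : Type*} [MeasurableSpace E] (μ : Measure E)
    [IsProbabilityMeasure μ] {n : ℕ} {k l : Fin n} (hkl : k ≠ l) {w : E × E → ℝ}
    (hw : Measurable w) :
    ∫ z : Fin n → E, w (z k, z l) ∂(Measure.pi fun _ => μ) = ∫ q, w q ∂(μ.prod μ) := by
  have hi := ProbabilityTheory.iIndepFun_pi (μ := fun _ : Fin n => μ) (X := fun _ z => z)
    fun _ => aemeasurable_id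
  have hp := (ProbabilityTheory.indepFun_iff_map_prod_eq_prod_map_map
    (measurable_pi_apply k).aemeasurable (measurable_pi_apply l).aemeasurable).1 (hi.indepFun hkl)
  have he (i : Fin n) : (Measure.pi fun _ : Fin n => μ).map (fun z => z i) = μ :=
    (measurePreserving_eval (fun _ : Fin n => μ) i).map_eq
  rw [he, he] at hp
  rw [← hp, integral_map (by fun_prop) hw.aestronglyMeasurable]

/-- If an affine combination of a linear and a quadratic empirical average is nonnegative for
almost every sample of every size, so is the limit given by the law of large numbers. -/
theorem nonneg_of_ae_nonneg_empirical {E : Type*} [MeasurableSpace E] (μ : Measure E)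
    [IsProbabilityMeasure μ] {u : E → ℝ} (hu : Measurable u) {w : E × E → ℝ} (hw : Measurable w)
    {C : ℝ} (huC : ∀ z, ‖u z‖ ≤ C) (hwC : ∀ q, ‖w q‖ ≤ C) (A : ℝ)
    (h : ∀ n : ℕ, 0 < n → ∀ᵐ z : Fin n → E ∂(Measure.pi fun _ => μ),
      0 ≤ A + 2 * ((n : ℝ)⁻¹ * ∑ k, u (z k)) + (n : ℝ)⁻¹ ^ 2 * ∑ k, ∑ l, w (z k, z l)) :
    0 ≤ A + 2 * ∫ z, u z ∂μ + ∫ q, w q ∂(μ.prod μ) := by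
  set m := ∫ z, u z ∂μ
  set q := ∫ q, w q ∂(μ.prod μ)
  set r := ∫ z, w (z, z) ∂μ
  -- Integration over the sample replaces a limit theorem: the off-diagonal pairs have mean `q`, and
  -- the `n` diagonal ones have mean `r`, which leaves a correction of order `1/n`.
  have key (n : ℕ) (hn : 0 < n) : 0 ≤ A + 2 * m + q + (r - q) * (n : ℝ)⁻¹ := by
    have hiu (k : Fin n) : Integrable (fun z : Fin n → E => u (z k)) (Measure.pi fun _ => μ) :=
      .of_bound (hu.comp (measurable_pi_apply k)).aestronglyMeasurable C
        (.of_forall fun z => huC _)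
    have hiw (k l : Fin n) :
        Integrable (fun z : Fin n → E => w (z k, z l)) (Measure.pi fun _ => μ) :=
      .of_bound (hw.comp ((measurable_pi_apply k).prodMk
        (measurable_pi_apply l))).aestronglyMeasurable C (.of_forall fun z => hwC _)
    have h1 := integral_nonneg_of_ae (h n hn)
    have hi1 : Integrable (fun z : Fin n → E => 2 * ((n : ℝ)⁻¹ * ∑ k, u (z k)))
        (Measure.pi fun _ => μ) :=
      ((integrable_finsetSum _ fun k _ => hiu k).const_mul _).const_mul _
    have hi2 : Integrable (fun z : Fin n → E => (n : ℝ)⁻¹ ^ 2 * ∑ k, ∑ l, w (z k, z l))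
        (Measure.pi fun _ => μ) :=
      (integrable_finsetSum _ fun k _ => integrable_finsetSum _ fun l _ => hiw k l).const_mul _
    have eu (k : Fin n) : ∫ z : Fin n → E, u (z k) ∂(Measure.pi fun _ => μ) = m := by
      have hk := measurePreserving_eval (fun _ : Fin n => μ) k
      have := integral_map (f := u) hk.aemeasurable hu.aestronglyMeasurable
      rw [hk.map_eq] at this
      exact this.symm
    have ew (k l : Fin n) : ∫ z : Fin n → E, w (z k, z l) ∂(Measure.pi fun _ => μ)
        = q + if k = l then r - q else 0 := by
      split_ifs with hkl
      · subst hkl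
        have hk := measurePreserving_eval (fun _ : Fin n => μ) k
        have := integral_map (f := fun z => w (z, z)) hk.aemeasurable
          (by fun_prop : Measurable fun z => w (z, z)).aestronglyMeasurable
        rw [hk.map_eq] at this
        rw [add_sub_cancel]
        exact this.symm
      · rw [integral_eval_pair μ hkl hw, add_zero]
    have hi3 : Integrable (fun z : Fin n → E => A + 2 * ((n : ℝ)⁻¹ * ∑ k, u (z k)))
        (Measure.pi fun _ => μ) := (integrable_const A).add hi1
    rw [integral_add hi3 hi2, integral_add (integrable_const _) hi1, integral_const,
      integral_const_mul, integral_const_mul, integral_const_mul,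
      integral_finsetSum _ (fun k _ => hiu k),
      integral_finsetSum _ (fun k _ => integrable_finsetSum _ fun l _ => hiw k l)] at h1
    simp_rw [integral_finsetSum _ (fun l _ => hiw _ l), eu, ew] at h1
    simp only [probReal_univ, one_smul, Finset.sum_const, Finset.card_univ, Fintype.card_fin,
      nsmul_eq_mul, Finset.sum_add_distrib, Finset.sum_ite_eq, Finset.mem_univ, if_true] at h1
    refine h1.trans_eq ?_
    have : (n : ℝ) ≠ 0 := by positivity
    field_simp
    ring
  have hlim : Tendsto (fun n : ℕ => A + 2 * m + q + (r - q) * (n : ℝ)⁻¹) atTop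
      (𝓝 (A + 2 * m + q + (r - q) * 0)) :=
    (tendsto_inv_atTop_nhds_zero_nat.const_mul _).const_add _
  rw [mul_zero, add_zero] at hlim
  exact ge_of_tendsto hlim (eventually_atTop.2 ⟨1, fun n hn => key n hn⟩)

/-! ### The operator bound and the inequality `B ≤ κ K[x]`. -/

/-- Any `κ` strictly between the norm and `1` works: it is positive, hence a legitimate divisor
later, and homogeneity carries the bound from the unit ball to all of `L²`. -/
theorem exists_eLpNorm_kernelApply_le (hK : kernelOpNorm K < 1) :
    ∃ κ : ℝ, 0 < κ ∧ κ < 1 ∧ ∀ g : Euc d → ℂ, MemLp g 2 volume →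
      eLpNorm (kernelApply volume K g) 2 volume ≤ ENNReal.ofReal κ * eLpNorm g 2 volume := by
  obtain ⟨κ, hκ, hκ1⟩ := exists_between hK
  have hκtop : κ ≠ ∞ := (hκ1.trans ENNReal.one_lt_top).ne
  refine ⟨κ.toReal, ENNReal.toReal_pos (ne_bot_of_gt hκ) hκtop, ?_, fun g hg => ?_⟩
  · rw [← ENNReal.toReal_one]
    exact (ENNReal.toReal_lt_toReal hκtop ENNReal.one_ne_top).2 hκ1
  rw [ENNReal.ofReal_toReal hκtop]
  by_cases h0 : eLpNorm g 2 volume = 0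
  · have hg0 := (eLpNorm_eq_zero_iff hg.1 two_ne_zero).1 h0
    have : kernelApply volume K g = 0 := by
      ext x
      refine integral_eq_zero_of_ae ?_
      filter_upwards [hg0] with y hy
      simp [hy]
    simp [this]
  set t : ℝ := (eLpNorm g 2 volume).toReal with ht
  have htpos : 0 < t := ENNReal.toReal_pos h0 hg.2.ne
  have hte : ‖((t : ℂ)⁻¹)‖ₑ = (eLpNorm g 2 volume)⁻¹ := by
    rw [enorm_inv (by exact_mod_cast htpos.ne'), ← ofReal_norm, Complex.norm_real,
      Real.norm_of_nonneg htpos.le, ht, ENNReal.ofReal_toReal hg.2.ne]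
  have hsmul : kernelApply volume K ((t : ℂ)⁻¹ • g) = (t : ℂ)⁻¹ • kernelApply volume K g := by
    ext x
    simp only [kernelApply, Pi.smul_apply, smul_eq_mul]
    rw [← integral_const_mul]
    congr 1 with y
    ring
  have h1 : eLpNorm (kernelApply volume K ((t : ℂ)⁻¹ • g)) 2 volume ≤ κ := by
    refine le_trans ?_ hκ.le
    refine le_iSup₂_of_le ((t : ℂ)⁻¹ • g) (hg.const_smul _) ?_
    refine le_iSup_of_le ?_ le_rfl
    rw [eLpNorm_const_smul, hte, ENNReal.inv_mul_cancel h0 hg.2.ne]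
  rw [hsmul, eLpNorm_const_smul, hte] at h1
  rwa [ENNReal.inv_mul_le_iff h0 hg.2.ne, mul_comm] at h1

/-- The quadratic form of the integral operator is bounded by `κ ‖g‖²`. -/
theorem integral_quadraticForm_le (hKm : Measurable fun z : Euc d × Euc d => K z.1 z.2)
    {M : ℝ} (hKM : ∀ x y, ‖K x y‖ ≤ M) {κ : ℝ} (hκ0 : 0 < κ)
    (hκ : ∀ g : Euc d → ℂ, MemLp g 2 volume →
      eLpNorm (kernelApply volume K g) 2 volume ≤ ENNReal.ofReal κ * eLpNorm g 2 volume)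
    {W : Set (Euc d)} (hW : MeasurableSet W) (hWfin : volume W ≠ ∞)
    {g : Euc d → ℂ} (hg : Measurable g) {C : ℝ} (hgC : ∀ z, ‖g z‖ ≤ C) :
    ∫ q, (star (g q.1) * K q.1 q.2 * g q.2).re ∂((volume.restrict W).prod (volume.restrict W))
      ≤ κ * ∫ z in W, ‖g z‖ ^ 2 := by
  have : IsFiniteMeasure (volume.restrict W) := ⟨by simpa using hWfin.lt_top⟩
  -- Extension by zero makes the bound on the whole space applicable to the window.
  set G := W.indicator g with hG
  have hGL : MemLp G 2 volume := by
    rw [hG, memLp_indicator_iff_restrict hW]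
    exact .of_bound hg.aestronglyMeasurable C (.of_forall hgC)
  set T := kernelApply volume K G with hT
  have hTapp (x : Euc d) : T x = ∫ y in W, K x y * g y := by
    rw [hT, kernelApply, ← integral_indicator hW]
    congr 1 with y
    by_cases hy : y ∈ W <;> simp [hG, hy]
  have hTm : AEStronglyMeasurable T volume := by
    have : StronglyMeasurable fun x => ∫ y in W, K x y * g y := by
      apply StronglyMeasurable.integral_prod_right
      exact (hKm.mul (hg.comp measurable_snd)).stronglyMeasurable
    rw [show T = _ from funext hTapp]
    exact this.aestronglyMeasurable
  have hTL : MemLp T 2 volume :=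
    ⟨hTm, (hκ G hGL).trans_lt (ENNReal.mul_lt_top ENNReal.ofReal_lt_top hGL.2)⟩
  have hnT : ‖hTL.toLp T‖ ≤ κ * ‖hGL.toLp G‖ := by
    rw [Lp.norm_toLp, Lp.norm_toLp]
    have := ENNReal.toReal_mono (ENNReal.mul_ne_top ENNReal.ofReal_ne_top hGL.2.ne) (hκ G hGL)
    rwa [ENNReal.toReal_mul, ENNReal.toReal_ofReal hκ0.le] at this
  have hnG : ‖hGL.toLp G‖ ^ 2 = ∫ z in W, ‖g z‖ ^ 2 := by
    rw [← integral_indicator hW]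
    have h1 : (inner ℂ (hGL.toLp G) (hGL.toLp G)).re = ‖hGL.toLp G‖ ^ 2 := by
      rw [inner_self_eq_norm_sq_to_K]
      norm_cast
    rw [← h1, L2.inner_def, ← RCLike.re_eq_complex_re, ← integral_re (L2.integrable_inner _ _)]
    refine integral_congr_ae ?_
    filter_upwards [hGL.coeFn_toLp] with z hz
    rw [hz, inner_self_eq_norm_sq_to_K]
    by_cases h : z ∈ W
    · simp only [hG, h, Set.indicator_of_mem]
      norm_cast
    · simp [hG, h]
  have hint : Integrable (fun q : Euc d × Euc d => star (g q.1) * K q.1 q.2 * g q.2)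
      ((volume.restrict W).prod (volume.restrict W)) := by
    refine .of_bound (C := C * M * C) ?_ (.of_forall fun q => ?_)
    · exact (((continuous_star.measurable.comp (hg.comp measurable_fst)).mul hKm).mul
        (hg.comp measurable_snd)).aestronglyMeasurable
    · have hC : 0 ≤ C := (norm_nonneg _).trans (hgC q.1)
      have hM : 0 ≤ M := (norm_nonneg _).trans (hKM q.1 q.1)
      rw [norm_mul, norm_mul, norm_star]
      gcongr
      exacts [hgC _, hKM _ _, hgC _]
  have hinner : ∫ q, star (g q.1) * K q.1 q.2 * g q.2
      ∂((volume.restrict W).prod (volume.restrict W)) = inner ℂ (hGL.toLp G) (hTL.toLp T) := by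
    rw [integral_prod _ hint, L2.inner_def, ← integral_indicator hW]
    refine integral_congr_ae ?_
    filter_upwards [hGL.coeFn_toLp, hTL.coeFn_toLp] with z hz hz'
    rw [hz, hz', RCLike.inner_apply']
    by_cases h : z ∈ W
    · simp only [hG, h, Set.indicator_of_mem, hTapp, mul_assoc]
      rw [integral_const_mul]
      rfl
    · simp [hG, h]
  calc _ = (inner ℂ (hGL.toLp G) (hTL.toLp T)).re := by
        rw [← hinner, ← RCLike.re_eq_complex_re, ← integral_re hint]
    _ ≤ ‖inner ℂ (hGL.toLp G) (hTL.toLp T)‖ := Complex.re_le_norm _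
    _ ≤ ‖hGL.toLp G‖ * ‖hTL.toLp T‖ := norm_inner_le_norm _ _
    _ ≤ ‖hGL.toLp G‖ * (κ * ‖hGL.toLp G‖) := by gcongr
    _ = κ * ‖hGL.toLp G‖ ^ 2 := by ring
    _ = _ := by rw [hnG]

open Matrix in
/-- Expansion of the quadratic form of `K[x, z]` at the vector `(c, s g(z))`, where
`g(z) = ∑ⱼ K(z, xⱼ) cⱼ`. -/
theorem quadraticForm_sumElim {E : Type*} {K : E → E → ℂ} (hK : ∀ x y, K y x = star (K x y))
    {p n : ℕ} (x : Fin p → E) (z : Fin n → E) (c : Fin p → ℂ) (s : ℝ) (g : E → ℂ)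
    (hg : ∀ y, g y = ∑ j, K y (x j) * c j) :
    star (Sum.elim c fun k => (s : ℂ) * g (z k)) ⬝ᵥ
        ((Matrix.of fun i j : Fin p ⊕ Fin n => K (Sum.elim x z i) (Sum.elim x z j)) *ᵥ
          (Sum.elim c fun k => (s : ℂ) * g (z k)))
      = star c ⬝ᵥ ((Matrix.of fun i j => K (x i) (x j)) *ᵥ c)
        + 2 * s * ∑ k, ((‖g (z k)‖ ^ 2 : ℝ) : ℂ)
        + s ^ 2 * ∑ k, ∑ l, star (g (z k)) * K (z k) (z l) * g (z l) := by
  have hsq (w : ℂ) : ((‖w‖ ^ 2 : ℝ) : ℂ) = star w * w := by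
    rw [Complex.star_def, Complex.conj_mul']
    push_cast
    rfl
  have hgs (y : E) : star (g y) = ∑ i, star (c i) * K (x i) y := by
    rw [hg, star_sum]
    refine Finset.sum_congr rfl fun i _ => ?_
    rw [star_mul', mul_comm, ← hK]
  have h12 : ∑ i, star (c i) * ∑ k, K (x i) (z k) * ((s : ℂ) * g (z k))
      = s * ∑ k, star (g (z k)) * g (z k) := by
    simp_rw [hgs, Finset.mul_sum, Finset.sum_mul, Finset.mul_sum]
    rw [Finset.sum_comm]
    refine Finset.sum_congr rfl fun k _ => Finset.sum_congr rfl fun i _ => ?_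
    ring
  have h21 : ∑ k, star ((s : ℂ) * g (z k)) * ∑ j, K (z k) (x j) * c j
      = s * ∑ k, star (g (z k)) * g (z k) := by
    simp_rw [← hg, Finset.mul_sum]
    refine Finset.sum_congr rfl fun k _ => ?_
    rw [star_mul', Complex.star_def, Complex.conj_ofReal, mul_assoc]
  have h22 : ∑ k, star ((s : ℂ) * g (z k)) * ∑ l, K (z k) (z l) * ((s : ℂ) * g (z l))
      = s ^ 2 * ∑ k, ∑ l, star (g (z k)) * K (z k) (z l) * g (z l) := by
    simp_rw [Finset.mul_sum]
    refine Finset.sum_congr rfl fun k _ => Finset.sum_congr rfl fun l _ => ?_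
    rw [star_mul', Complex.star_def, Complex.conj_ofReal]
    ring
  simp only [dotProduct, mulVec, Fintype.sum_sum_type, Pi.star_apply, Sum.elim_inl, Sum.elim_inr,
    Matrix.of_apply, mul_add, Finset.sum_add_distrib]
  rw [h12, h21, h22]
  simp_rw [hsq]
  ring

/-- Lets statements valid for Lebesgue-almost every `z` be used for samples from the uniform law on
`W`. -/
theorem pi_smul_absolutelyContinuous {E : Type*} [MeasurableSpace E] (ν : Measure E)
    [IsFiniteMeasure ν] {a : ℝ≥0∞} (ha : a ≠ ∞) (n : ℕ) :
    (Measure.pi fun _ : Fin n => a • ν) ≪ Measure.pi fun _ : Fin n => ν := by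
  have : IsFiniteMeasure (a • ν) := ν.smul_finite ha
  have h : (Measure.pi fun _ : Fin n => a • ν) = a ^ n • Measure.pi fun _ : Fin n => ν := by
    refine Measure.pi_eq fun s _ => ?_
    simp [Measure.smul_apply, Measure.pi_pi, Finset.prod_mul_distrib]
  rw [h]
  exact Measure.smul_absolutelyContinuous

/-- The matrix of the kernel `∫_W K(x, z) K(z, y) dz` is at most `κ K[x]`. -/
theorem posSemidef_smul_kernelMatrix_sub (hKh : ∀ x y, K y x = star (K x y))
    (hKm : Measurable fun z : Euc d × Euc d => K z.1 z.2)
    {M : ℝ} (hKM : ∀ x y, ‖K x y‖ ≤ M) {κ : ℝ} (hκ0 : 0 < κ)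
    (hκ : ∀ g : Euc d → ℂ, MemLp g 2 volume →
      eLpNorm (kernelApply volume K g) 2 volume ≤ ENNReal.ofReal κ * eLpNorm g 2 volume)
    {W : Set (Euc d)} (hW : MeasurableSet W) (hWfin : volume W ≠ ∞) (hW0 : volume W ≠ 0)
    {p : ℕ} (x : Fin p → Euc d)
    (hx : ∀ n : ℕ, ∀ᵐ z : Fin n → Euc d,
      (Matrix.of fun i j : Fin p ⊕ Fin n => K (Sum.elim x z i) (Sum.elim x z j)).PosSemidef) :
    ((κ : ℂ) • kernelMatrix K x
      - Matrix.of fun i j => ∫ z in W, K (x i) z * K z (x j)).PosSemidef := by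
  have hfin : IsFiniteMeasure (volume.restrict W) := ⟨by simpa using hWfin.lt_top⟩
  have hM0 : 0 ≤ M := (norm_nonneg _).trans (hKM 0 0)
  have hKy (y : Euc d) : Measurable fun z => K z y := hKm.comp (measurable_id.prodMk measurable_const)
  have hKy' (y : Euc d) : Measurable fun z => K y z := hKm.comp (measurable_const.prodMk measurable_id)
  have hherm : ((κ : ℂ) • kernelMatrix K x
      - Matrix.of fun i j => ∫ z in W, K (x i) z * K z (x j)).IsHermitian := by
    refine Matrix.IsHermitian.sub ?_ ?_
    · ext i j
      simp [kernelMatrix, hKh (x i) (x j)]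
    · ext i j
      rw [Matrix.conjTranspose_apply, Matrix.of_apply, Matrix.of_apply, Complex.star_def,
        ← integral_conj]
      congr 1 with z
      rw [map_mul, ← Complex.star_def, ← hKh, ← hKh, mul_comm]
  refine Matrix.PosSemidef.of_dotProduct_mulVec_nonneg hherm fun c => ?_
  rw [Complex.le_def]
  refine ⟨?_, (hherm.im_star_dotProduct_mulVec_self c).symm⟩
  -- With this `g`, the quadratic form of `B` at `c` is `∫_W ‖g‖²`.
  set g : Euc d → ℂ := fun y => ∑ j, K y (x j) * c j with hgdef
  have hg : Measurable g := Finset.measurable_fun_sum _ fun j _ => (hKy _).mul_const _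
  set C : ℝ := ∑ j, M * ‖c j‖ with hC
  have hgC (y : Euc d) : ‖g y‖ ≤ C := by
    refine (norm_sum_le _ _).trans (Finset.sum_le_sum fun j _ => ?_)
    rw [norm_mul]
    gcongr
    exact hKM _ _
  have hC0 : 0 ≤ C := (norm_nonneg _).trans (hgC 0)
  have hgs (y : Euc d) : star (g y) = ∑ i, star (c i) * K (x i) y := by
    rw [hgdef, star_sum]
    refine Finset.sum_congr rfl fun i _ => ?_
    rw [star_mul', mul_comm, ← hKh]
  have hB : star c ⬝ᵥ ((Matrix.of fun i j => ∫ z in W, K (x i) z * K z (x j)).mulVec c)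
      = ((∫ z in W, ‖g z‖ ^ 2 : ℝ) : ℂ) := by
    have hint (i j : Fin p) : Integrable (fun z => star (c i) * (K (x i) z * K z (x j) * c j))
        (volume.restrict W) := by
      refine .of_bound (C := ‖c i‖ * (M * M * ‖c j‖)) ?_ (.of_forall fun z => ?_)
      · exact ((((hKy' _).mul (hKy _)).mul_const _).const_mul _).aestronglyMeasurable
      · rw [norm_mul, norm_mul, norm_mul, norm_star]
        gcongr <;> exact hKM _ _
    simp only [dotProduct, Matrix.mulVec, Matrix.of_apply, Pi.star_apply, Finset.mul_sum]
    simp_rw [← integral_mul_const, ← integral_const_mul]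
    simp_rw [← integral_finsetSum _ fun j _ => hint _ j]
    rw [← integral_finsetSum _ fun i _ => integrable_finsetSum _ fun j _ => hint i j,
      ← integral_complex_ofReal]
    congr 1 with z
    rw [Complex.ofReal_pow, ← Complex.conj_mul', ← Complex.star_def, hgs, Finset.sum_mul]
    refine Finset.sum_congr rfl fun i _ => ?_
    rw [hgdef, Finset.mul_sum]
    refine Finset.sum_congr rfl fun j _ => ?_
    ring
  set V : ℝ := volume.real W with hV
  have hVpos : 0 < V := ENNReal.toReal_pos hW0 hWfin
  set μ : Measure (Euc d) := (volume W)⁻¹ • volume.restrict W with hμ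
  have hinv : (volume W)⁻¹ ≠ ∞ := ENNReal.inv_ne_top.2 hW0
  have hμp : IsProbabilityMeasure μ := ⟨by
    simp [hμ, ENNReal.inv_mul_cancel hW0 hWfin]⟩
  set A : ℝ := (star c ⬝ᵥ ((kernelMatrix K x).mulVec c)).re
  -- With `I = ∫_W ‖g‖²`, the limiting form is at most `A + 2tI/V + t²κI/V²`, and this `t` minimises
  -- that bound, with value `A - I/κ`.
  set t : ℝ := -(V / κ) with ht
  set u : Euc d → ℝ := fun z => t * ‖g z‖ ^ 2 with hu
  set w : Euc d × Euc d → ℝ := fun q => t ^ 2 * (star (g q.1) * K q.1 q.2 * g q.2).re with hw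
  have hum : Measurable u := (hg.norm.pow_const 2).const_mul t
  have hwm : Measurable w :=
    (Complex.measurable_re.comp (((continuous_star.measurable.comp (hg.comp measurable_fst)).mul
      hKm).mul (hg.comp measurable_snd))).const_mul _
  have huC (z : Euc d) : ‖u z‖ ≤ |t| * C ^ 2 + t ^ 2 * (C * M * C) := by
    rw [hu, norm_mul, Real.norm_eq_abs, norm_pow, norm_norm]
    have : |t| * ‖g z‖ ^ 2 ≤ |t| * C ^ 2 := by gcongr; exact hgC z
    have : 0 ≤ t ^ 2 * (C * M * C) := by positivity
    linarith
  have hwC (q : Euc d × Euc d) : ‖w q‖ ≤ |t| * C ^ 2 + t ^ 2 * (C * M * C) := by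
    rw [hw, norm_mul, norm_pow, Real.norm_eq_abs, sq_abs, Real.norm_eq_abs]
    have h1 : |(star (g q.1) * K q.1 q.2 * g q.2).re| ≤ C * M * C := by
      refine (Complex.abs_re_le_norm _).trans ?_
      rw [norm_mul, norm_mul, norm_star]
      gcongr
      exacts [hgC _, hKM _ _, hgC _]
    have : t ^ 2 * |(star (g q.1) * K q.1 q.2 * g q.2).re| ≤ t ^ 2 * (C * M * C) := by gcongr
    have : 0 ≤ |t| * C ^ 2 := by positivity
    linarith
  have hlln := nonneg_of_ae_nonneg_empirical μ hum hwm huC hwC A fun n hn => by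
    have h1 : ∀ᵐ z : Fin n → Euc d ∂(Measure.pi fun _ => μ),
        (Matrix.of fun i j : Fin p ⊕ Fin n => K (Sum.elim x z i) (Sum.elim x z j)).PosSemidef := by
      refine (pi_smul_absolutelyContinuous (volume.restrict W) hinv n).ae_le ?_
      rw [← Measure.restrict_pi_pi]
      exact ae_restrict_of_ae (hx n)
    filter_upwards [h1] with z hz
    -- The weights `t g(z_k)/n` turn the mixed terms into an average over the sample and the last
    -- block into an average over pairs.
    have h2 := hz.dotProduct_mulVec_nonneg (Sum.elim c fun k => ((t * (n : ℝ)⁻¹ : ℝ) : ℂ) * g (z k))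
    rw [quadraticForm_sumElim hKh x z c _ g fun y => rfl] at h2
    have h3 := (Complex.le_def.1 h2).1
    rw [Complex.zero_re, Complex.add_re, Complex.add_re] at h3
    convert h3 using 2
    · congr 1
      rw [← Complex.ofReal_sum, ← Complex.ofReal_ofNat, ← Complex.ofReal_mul, ← Complex.ofReal_mul,
        Complex.ofReal_re, hu, ← Finset.mul_sum]
      ring
    · rw [← Complex.ofReal_pow, Complex.re_ofReal_mul, Complex.re_sum]
      simp_rw [Complex.re_sum, hw, ← Finset.mul_sum]
      ring
  have hmu : ∫ z, u z ∂μ = t * (V⁻¹ * ∫ z in W, ‖g z‖ ^ 2) := by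
    rw [hu, integral_const_mul, hμ, integral_smul_measure, ENNReal.toReal_inv, smul_eq_mul]
    rfl
  have hmw : ∫ q, w q ∂(μ.prod μ) = t ^ 2 * (V⁻¹ * (V⁻¹ *
      ∫ q, (star (g q.1) * K q.1 q.2 * g q.2).re
        ∂((volume.restrict W).prod (volume.restrict W)))) := by
    rw [hw, integral_const_mul, hμ, Measure.prod_smul_left, Measure.prod_smul_right,
      integral_smul_measure, integral_smul_measure, ENNReal.toReal_inv, smul_eq_mul, smul_eq_mul]
    rfl
  have hop := integral_quadraticForm_le hKm hKM hκ0 hκ hW hWfin hg hgC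
  rw [hmu, hmw] at hlln
  set I := ∫ z in W, ‖g z‖ ^ 2
  set J := ∫ q, (star (g q.1) * K q.1 q.2 * g q.2).re
    ∂((volume.restrict W).prod (volume.restrict W))
  have hfinal : 0 ≤ κ * A - I := by
    have h1 : A + 2 * (t * (V⁻¹ * I)) + t ^ 2 * (V⁻¹ * (V⁻¹ * J)) = A - 2 * I / κ + J / κ ^ 2 := by
      rw [ht]
      field_simp
      ring
    rw [h1] at hlln
    -- This is the operator bound `J ≤ κ I`.
    have h2 : J / κ ^ 2 ≤ I / κ := by
      rw [div_le_div_iff₀ (by positivity) hκ0]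
      nlinarith
    have h3 : 0 ≤ A - I / κ := by
      have : 2 * I / κ = I / κ + I / κ := by ring
      linarith
    have h4 : κ * (A - I / κ) = κ * A - I := by field_simp
    rw [← h4]
    positivity
  rw [Matrix.sub_mulVec, dotProduct_sub, hB, Matrix.smul_mulVec, dotProduct_smul, smul_eq_mul]
  simpa using hfinal

/-! ### The effect of conditioning on `x`. -/

/-- The determinant of `K[y, x]` as a Schur complement. -/
theorem det_kernelMatrix_cons {p : ℕ} (x : Fin p → Euc d) (y : Euc d)
    (h : (kernelMatrix K x).det ≠ 0) :
    (kernelMatrix K (Fin.cons y x)).det = (kernelMatrix K x).det *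
      (K y y - ∑ i, ∑ j, K y (x i) * (kernelMatrix K x)⁻¹ i j * K (x j) y) := by
  -- Moves `y` from the first place to the last block; rows and columns are permuted alike, so the
  -- determinant is unchanged.
  set e : Fin p ⊕ Unit ≃ Fin (p + 1) := (Equiv.optionEquivSumPUnit _).symm.trans (finSuccEquiv p).symm
  have hblock : (kernelMatrix K (Fin.cons y x)).submatrix e e
      = Matrix.fromBlocks (kernelMatrix K x) (Matrix.of fun i _ => K (x i) y)
        (Matrix.of fun _ j => K y (x j)) (Matrix.of fun _ _ => K y y) := by
    ext i j
    rcases i with i | i <;> rcases j with j | j <;> simp [e, kernelMatrix]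
  have : Invertible (kernelMatrix K x) := Matrix.invertibleOfIsUnitDet _ (isUnit_iff_ne_zero.2 h)
  rw [← Matrix.det_submatrix_equiv_self e, hblock, Matrix.det_fromBlocks₁₁, Matrix.det_unique (n := Unit),
    Matrix.invOf_eq_nonsing_inv, Matrix.sub_apply, Matrix.mul_apply]
  simp_rw [Matrix.mul_apply, Finset.sum_mul]
  rw [Finset.sum_comm]
  rfl

/-- Conditioning on the points `x` lowers the expected number of points in `W` by at most `κ p`. -/
theorem det_mul_lintegral_le (hKh : ∀ x y, K y x = star (K x y))
    (hKm : Measurable fun z : Euc d × Euc d => K z.1 z.2)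
    {M : ℝ} (hKM : ∀ x y, ‖K x y‖ ≤ M) {κ : ℝ} (hκ0 : 0 < κ)
    (hκ : ∀ g : Euc d → ℂ, MemLp g 2 volume →
      eLpNorm (kernelApply volume K g) 2 volume ≤ ENNReal.ofReal κ * eLpNorm g 2 volume)
    {W : Set (Euc d)} (hW : MeasurableSet W) (hWfin : volume W ≠ ∞) (hW0 : volume W ≠ 0)
    {p : ℕ} (x : Fin p → Euc d)
    (hx : ∀ n : ℕ, ∀ᵐ z : Fin n → Euc d,
      (Matrix.of fun i j : Fin p ⊕ Fin n => K (Sum.elim x z i) (Sum.elim x z j)).PosSemidef) :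
    ENNReal.ofReal (kernelMatrix K x).det.re * ∫⁻ y in W, ENNReal.ofReal (K y y).re
      ≤ (∫⁻ y in W, ENNReal.ofReal (kernelMatrix K (Fin.cons y x : Fin (p + 1) → Euc d)).det.re)
        + ENNReal.ofReal (κ * p) * ENNReal.ofReal (kernelMatrix K x).det.re := by
  have hfin : IsFiniteMeasure (volume.restrict W) := ⟨by simpa using hWfin.lt_top⟩
  have hM0 : 0 ≤ M := (norm_nonneg _).trans (hKM 0 0)
  have hKy (y : Euc d) : Measurable fun z => K z y := hKm.comp (measurable_id.prodMk measurable_const)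
  have hKy' (y : Euc d) : Measurable fun z => K y z := hKm.comp (measurable_const.prodMk measurable_id)
  have hKd : Measurable fun y => K y y := hKm.comp (measurable_id.prodMk measurable_id)
  have hpsd : (kernelMatrix K x).PosSemidef := by
    obtain ⟨z, hz⟩ := (hx 0).exists
    exact hz.submatrix Sum.inl
  have hy : ∀ᵐ y : Euc d, 0 ≤ (K y y).re ∧
      0 ≤ (kernelMatrix K (Fin.cons y x : Fin (p + 1) → Euc d)).det.re := by
    have h1 := (volume_preserving_funUnique (Fin 1) (Euc d)).symm.quasiMeasurePreserving.ae (hx 1)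
    filter_upwards [h1] with y hy
    refine ⟨(Complex.le_def.1 (hy.diag_nonneg (i := Sum.inr 0))).1, ?_⟩
    set f : Fin (p + 1) → Fin p ⊕ Fin 1 := Fin.cons (Sum.inr 0) Sum.inl with hf
    have hsub : (kernelMatrix K (Fin.cons y x : Fin (p + 1) → Euc d)).PosSemidef := by
      convert hy.submatrix f using 1
      have he (i : Fin (p + 1)) : (Fin.cons y x : Fin (p + 1) → Euc d) i
          = Sum.elim x ((MeasurableEquiv.funUnique (Fin 1) (Euc d)).symm y) (f i) := by
        refine Fin.cases ?_ (fun i => ?_) i <;> rfl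
      ext i j
      simp [kernelMatrix, he]
    exact (Complex.le_def.1 hsub.det_nonneg).1
  have hD0 := hpsd.det_nonneg
  -- If `K[x]` is singular, the left side vanishes; otherwise it is positive definite and can be
  -- inverted.
  by_cases hD : (kernelMatrix K x).det = 0
  · simp [hD]
  have hDre : (((kernelMatrix K x).det.re : ℝ) : ℂ) = (kernelMatrix K x).det :=
    Complex.ext rfl (by simpa using (Complex.le_def.1 hD0).2)
  set D : ℝ := (kernelMatrix K x).det.re with hDdef
  have hDnn : 0 ≤ D := (Complex.le_def.1 hD0).1
  set R := (kernelMatrix K x)⁻¹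
  set B : Matrix (Fin p) (Fin p) ℂ := Matrix.of fun i j => ∫ z in W, K (x i) z * K z (x j)
  -- The trace of `K[x]⁻¹ B` is exactly the loss in the expected number of points.
  have htr : (R * B).trace.re ≤ κ * p := by
    have := (hpsd.posDef_iff_det_ne_zero.2 hD).trace_inv_mul_le
      (posSemidef_smul_kernelMatrix_sub hKh hKm hKM hκ0 hκ hW hWfin hW0 x hx)
    simpa using this
  have hi1 : Integrable (fun y => K y y) (volume.restrict W) :=
    .of_bound hKd.aestronglyMeasurable M (.of_forall fun y => hKM _ _)
  have hi2 (i j : Fin p) : Integrable (fun y => K y (x i) * R i j * K (x j) y)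
      (volume.restrict W) := by
    refine .of_bound (C := M * ‖R i j‖ * M)
      (((hKy _).mul_const _).mul (hKy' _)).aestronglyMeasurable (.of_forall fun y => ?_)
    rw [norm_mul, norm_mul]
    gcongr <;> exact hKM _ _
  have hi3 : Integrable (fun y => ∑ i, ∑ j, K y (x i) * R i j * K (x j) y) (volume.restrict W) :=
    integrable_finsetSum _ fun i _ => integrable_finsetSum _ fun j _ => hi2 i j
  have hi4 : Integrable (fun y => (kernelMatrix K (Fin.cons y x : Fin (p + 1) → Euc d)).det)
      (volume.restrict W) := by
    simp_rw [det_kernelMatrix_cons x _ hD]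
    exact (hi1.sub hi3).const_mul _
  have hint : ∫ y in W, (kernelMatrix K (Fin.cons y x : Fin (p + 1) → Euc d)).det
      = D * ((∫ y in W, K y y) - (R * B).trace) := by
    simp_rw [det_kernelMatrix_cons x _ hD]
    rw [integral_const_mul, integral_sub hi1 hi3, ← hDre,
      integral_finsetSum _ fun i _ => integrable_finsetSum _ fun j _ => hi2 i j]
    simp_rw [integral_finsetSum _ fun j _ => hi2 _ j]
    congr 2
    simp only [Matrix.trace, Matrix.diag_apply, Matrix.mul_apply, B, Matrix.of_apply,
      ← integral_const_mul]
    refine Finset.sum_congr rfl fun i _ => Finset.sum_congr rfl fun j _ => ?_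
    congr 1 with y
    ring
  have hre1 : ∫⁻ y in W, ENNReal.ofReal (K y y).re = ENNReal.ofReal (∫ y in W, K y y).re := by
    rw [← RCLike.re_eq_complex_re, ← integral_re hi1, ofReal_integral_eq_lintegral_ofReal hi1.re
      (ae_restrict_of_ae (hy.mono fun y h => h.1))]
  have hre2 : ∫⁻ y in W, ENNReal.ofReal (kernelMatrix K (Fin.cons y x : Fin (p + 1) → Euc d)).det.re
      = ENNReal.ofReal (∫ y in W, (kernelMatrix K (Fin.cons y x : Fin (p + 1) → Euc d)).det).re := by
    rw [← RCLike.re_eq_complex_re, ← integral_re hi4, ofReal_integral_eq_lintegral_ofReal hi4.re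
      (ae_restrict_of_ae (hy.mono fun y h => h.2))]
  rw [hre1, hre2, hint, ← ENNReal.ofReal_mul hDnn, ← ENNReal.ofReal_mul (by positivity)]
  refine (ENNReal.ofReal_le_ofReal ?_).trans ENNReal.ofReal_add_le
  rw [Complex.re_ofReal_mul, Complex.sub_re]
  nlinarith

/-! ### Combinatorics of sums over tuples and subsets. -/

/-- The sum of `g` over the `p`-tuples of pairwise distinct points of `s`. -/
noncomputable def tupleSum {E : Type*} {p : ℕ} (g : (Fin p → E) → ℝ≥0∞) (s : Set E) : ℝ≥0∞ :=
  ∑' x : {x : Fin p → E // Function.Injective x ∧ ∀ i, x i ∈ s}, g x.1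

theorem tupleSum_indicator {E : Type*} {p : ℕ} (g : (Fin p → E) → ℝ≥0∞) (s W : Set E) :
    tupleSum ((Set.univ.pi fun _ => W).indicator g) s = tupleSum g (s ∩ W) := by
  have h (t : Set E) (g : (Fin p → E) → ℝ≥0∞) :
      tupleSum g t = ∑' x, {x : Fin p → E | Function.Injective x ∧ ∀ i, x i ∈ t}.indicator g x :=
    tsum_subtype {x : Fin p → E | Function.Injective x ∧ ∀ i, x i ∈ t} g
  rw [h, h]
  congr 1 with x
  rw [Set.indicator_indicator]
  congr 1
  ext y
  simp only [Set.mem_inter_iff, Set.mem_ofPred_eq, Set.mem_univ_pi]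
  grind

/-- Tuples with one more entry are obtained by adding a further point. -/
noncomputable def consTupleEquiv {E : Type*} (p : ℕ) (s : Set E) :
    (Σ x : {x : Fin p → E // Function.Injective x ∧ ∀ i, x i ∈ s}, ↥(s \ Set.range x.1)) ≃
      {x : Fin (p + 1) → E // Function.Injective x ∧ ∀ i, x i ∈ s} where
  toFun q := ⟨Fin.cons q.2.1 q.1.1, Fin.cons_injective_iff.2 ⟨q.2.2.2, q.1.2.1⟩,
    Fin.cases q.2.2.1 q.1.2.2⟩
  invFun x := ⟨⟨Fin.tail x.1, x.2.1.comp (Fin.succ_injective _), fun i => x.2.2 i.succ⟩,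
    ⟨x.1 0, x.2.2 0, by
      rintro ⟨i, hi⟩
      exact Fin.succ_ne_zero i (x.2.1 hi)⟩⟩
  left_inv q := rfl
  right_inv x := Subtype.ext (Fin.cons_self_tail x.1)

/-- For a fixed tuple, each point of `s` is either one of its `p` entries or a new point that
extends it to a `(p + 1)`-tuple. -/
theorem tupleSum_mul_encard {E : Type*} {p : ℕ} (g : (Fin p → E) → ℝ≥0∞) (s : Set E) :
    tupleSum g s * s.encard
      = p * tupleSum g s + tupleSum (fun x : Fin (p + 1) → E => g (Fin.tail x)) s := by
  have h1 : tupleSum (fun x : Fin (p + 1) → E => g (Fin.tail x)) s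
      = ∑' x : {x : Fin p → E // Function.Injective x ∧ ∀ i, x i ∈ s},
        g x.1 * (s \ Set.range x.1).encard := by
    rw [tupleSum, ← (consTupleEquiv p s).tsum_eq, ENNReal.tsum_sigma']
    congr 1 with x
    rw [← ENNReal.tsum_set_one, ← ENNReal.tsum_mul_left]
    exact tsum_congr fun b => (mul_one _).symm
  rw [h1, tupleSum, ← ENNReal.tsum_mul_left, ← ENNReal.tsum_add, ← ENNReal.tsum_mul_right]
  congr 1 with x
  have h2 : (Set.range x.1).encard = p := by
    rw [← Set.image_univ, x.2.1.encard_image, Set.encard_univ]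
    simp
  have h3 : (s.encard : ℝ≥0∞) = (s \ Set.range x.1).encard + p := by
    rw [← Set.encard_sdiff_add_encard_of_subset (Set.range_subset_iff.2 x.2.2), h2]
    simp
  rw [h3]
  ring

theorem tupleSum_one {E : Type*} (s : Set E) :
    tupleSum (fun _ : Fin 1 → E => 1) s = s.encard := by
  rw [tupleSum, ← ENNReal.tsum_set_one]
  refine ((Equiv.tsum_eq (⟨fun x => ⟨x.1 0, x.2.2 0⟩, fun y =>
    ⟨fun _ => y.1, Function.injective_of_subsingleton _, fun _ => y.2⟩, fun x => ?_, fun y => rfl⟩ :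
      {x : Fin 1 → E // Function.Injective x ∧ ∀ i, x i ∈ s} ≃ s) fun _ => 1))
  ext i
  simp [Subsingleton.elim i 0]

/-- Enumerations of the `p`-element subsets of `s` are the injective tuples. -/
noncomputable def enumEquiv {E : Type*} (p : ℕ) (s : Set E) :
    (Σ S : {S : Finset E // (S : Set E) ⊆ s ∧ S.card = p}, (Fin p ≃ S.1)) ≃
      {x : Fin p → E // Function.Injective x ∧ ∀ i, x i ∈ s} :=
  Equiv.ofBijective (fun q => ⟨fun i => (q.2 i : E), Subtype.val_injective.comp q.2.injective,
    fun i => q.1.2.1 (q.2 i).2⟩) <| by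
    classical
    constructor
    · rintro ⟨⟨S, hS⟩, e⟩ ⟨⟨S', hS'⟩, e'⟩ h
      have hfun : ∀ i, (e i : E) = e' i := fun i => congrFun (Subtype.ext_iff.1 h) i
      have hSS : S = S' := by
        ext y
        constructor
        · intro hy
          obtain ⟨i, hi⟩ := e.surjective ⟨y, hy⟩
          have h : y = e' i := by rw [← hfun i, hi]
          exact h ▸ (e' i).2
        · intro hy
          obtain ⟨i, hi⟩ := e'.surjective ⟨y, hy⟩
          have h : y = e i := by rw [hfun i, hi]
          exact h ▸ (e i).2
      subst hSS
      have : e = e' := Equiv.ext fun i => Subtype.ext (hfun i)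
      rw [this]
    · rintro ⟨x, hx, hs⟩
      refine ⟨⟨⟨Finset.univ.image x, ?_, ?_⟩, Equiv.ofBijective
        (fun i => ⟨x i, Finset.mem_image_of_mem _ (Finset.mem_univ _)⟩) ⟨?_, ?_⟩⟩, rfl⟩
      · intro y hy
        obtain ⟨i, -, rfl⟩ := Finset.mem_image.1 (Finset.mem_coe.1 hy)
        exact hs i
      · rw [Finset.card_image_of_injective _ hx, Finset.card_univ, Fintype.card_fin]
      · exact fun i j hij => hx (Subtype.ext_iff.1 hij)
      · rintro ⟨y, hy⟩
        obtain ⟨i, -, rfl⟩ := Finset.mem_image.1 hy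
        exact ⟨i, rfl⟩

theorem subsetSum_nonneg {d p : ℕ} {f : (Fin p → Euc d) → ℝ} (hf : ∀ x, 0 ≤ f x)
    (s : Set (Euc d)) : 0 ≤ subsetSum f s :=
  tsum_nonneg fun _ => hf _

/-- Each `p`-element set has `p!` enumerations, on all of which a symmetric `f` agrees. Finiteness
of `s` makes the real-valued sum a genuine one. -/
theorem tupleSum_eq_factorial_mul {d p : ℕ} {f : (Fin p → Euc d) → ℝ} (hf : ∀ x, 0 ≤ f x)
    (hf_symm : ∀ (σ : Equiv.Perm (Fin p)) (x : Fin p → Euc d), f (x ∘ σ) = f x)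
    {s : Set (Euc d)} (hs : s.Finite) :
    tupleSum (fun x => ENNReal.ofReal (f x)) s
      = p.factorial * ENNReal.ofReal (subsetSum f s) := by
  classical
  have hfin : Finite {S : Finset (Euc d) // (S : Set (Euc d)) ⊆ s ∧ S.card = p} := by
    refine Set.Finite.subset (hs.toFinset.powerset).finite_toSet fun S hS => ?_
    rw [Finset.mem_coe, Finset.mem_powerset]
    exact fun y hy => hs.mem_toFinset.2 (hS.1 hy)
  rw [subsetSum, ENNReal.ofReal_tsum_of_nonneg (fun _ => hf _) (Summable.of_finite),
    ← ENNReal.tsum_mul_left, tupleSum, ← (enumEquiv p s).tsum_eq, ENNReal.tsum_sigma']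
  congr 1 with S
  set e₀ := S.1.equivFinOfCardEq S.2.2
  have h (e : Fin p ≃ S.1) : ENNReal.ofReal (f ((enumEquiv p s) ⟨S, e⟩).1)
      = ENNReal.ofReal (f fun i => (e₀.symm i : Euc d)) := by
    rw [← hf_symm (e.trans e₀) fun i => (e₀.symm i : Euc d)]
    congr 2
    ext1 i
    exact (congrArg Subtype.val (e₀.symm_apply_apply (e i))).symm
  simp_rw [h]
  rw [tsum_fintype, Finset.sum_const, Finset.card_univ, Fintype.card_equiv e₀.symm,
    Fintype.card_fin, nsmul_eq_mul]

/-! ### Measurability on the space of configurations. -/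

theorem measurable_encard_inter {d : ℕ} {B : Set (Euc d)} (hB : MeasurableSet B) :
    Measurable fun s : PointConfig d => (((s.carrier ∩ B).encard : ℕ∞) : ℝ≥0∞) := by
  have hm (m : ℕ) : MeasurableSet {s : PointConfig d | (s.carrier ∩ B).encard = m} :=
    MeasurableSpace.measurableSet_generateFrom ⟨B, hB, m, rfl⟩
  have h : Measurable fun s : PointConfig d => (s.carrier ∩ B).encard := by
    refine measurable_to_countable' fun y => ?_
    induction y using ENat.recTopCoe with
    | coe m => exact hm m
    | top =>
      have : (fun s : PointConfig d => (s.carrier ∩ B).encard) ⁻¹' {⊤}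
          = (⋃ m : ℕ, {s : PointConfig d | (s.carrier ∩ B).encard = m})ᶜ := by
        ext s
        simp only [Set.mem_preimage, Set.mem_singleton_iff, Set.mem_compl_iff, Set.mem_iUnion,
          Set.mem_ofPred_eq, not_exists]
        refine ⟨fun h m => by simp [h], fun h => ?_⟩
        by_contra h'
        obtain ⟨m, hm⟩ := ENat.ne_top_iff_exists.1 h'
        exact h m hm.symm
      rw [this]
      exact (MeasurableSet.iUnion hm).compl
  exact (measurable_of_countable _).comp h

theorem encard_univ_pi {E : Type*} {p : ℕ} {A : Fin p → Set E} (hA : ∀ i, (A i).Finite) :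
    (((Set.univ.pi A).encard : ℕ∞) : ℝ≥0∞) = ∏ i, (((A i).encard : ℕ∞) : ℝ≥0∞) := by
  classical
  choose F hF using fun i => (hA i).exists_finset_coe
  obtain rfl : A = fun i => ↑(F i) := funext fun i => (hF i).symm
  rw [← Fintype.coe_piFinset, Set.encard_coe_eq_coe_finsetCard, Fintype.card_piFinset]
  simp_rw [Set.encard_coe_eq_coe_finsetCard, ENat.toENNReal_coe, Nat.cast_prod]

theorem measurableSet_injective {d p : ℕ} :
    MeasurableSet {x : Fin p → Euc d | Function.Injective x} := by
  have : {x : Fin p → Euc d | Function.Injective x}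
      = ⋂ (i : Fin p) (j : Fin p), {x | x i = x j → i = j} := by
    ext x
    simp [Function.Injective]
  rw [this]
  refine MeasurableSet.iInter fun i => MeasurableSet.iInter fun j => ?_
  by_cases hij : i = j
  · simp [hij]
  · simp only [hij, imp_false]
    exact (measurableSet_eq_fun (measurable_pi_apply i) (measurable_pi_apply j)).compl

/-- The sum is an integral against the counting measure on the tuples from `s ∩ W`. This finite
measure depends measurably on `s`, because on a box it is a product of point counts and boxes form a
generating π-system. -/
theorem measurable_tupleSum {d p : ℕ} {g : (Fin p → Euc d) → ℝ≥0∞} (hg : Measurable g)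
    {W : Set (Euc d)} (hW : MeasurableSet W) (hWb : Bornology.IsBounded W) :
    Measurable fun s : PointConfig d => tupleSum g (s.carrier ∩ W) := by
  set T : PointConfig d → Set (Fin p → Euc d) := fun s => Set.univ.pi fun _ => s.carrier ∩ W
  have hTfin (s : PointConfig d) : (T s).Finite := Set.Finite.pi fun _ => s.finite_inter W hWb
  set μ : PointConfig d → Measure (Fin p → Euc d) := fun s => Measure.count.restrict (T s)
  have hμfin (s : PointConfig d) : IsFiniteMeasure (μ s) := by
    refine isFiniteMeasure_restrict.2 ?_
    rw [Measure.count_apply (hTfin s).measurableSet]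
    simpa using hTfin s
  have hbox (B : Fin p → Set (Euc d)) (hB : ∀ i, MeasurableSet (B i)) :
      Measurable fun s => μ s (Set.univ.pi B) := by
    have (s : PointConfig d) : μ s (Set.univ.pi B)
        = ∏ i, (((s.carrier ∩ (W ∩ B i)).encard : ℕ∞) : ℝ≥0∞) := by
      rw [Measure.restrict_apply (MeasurableSet.univ_pi hB),
        Measure.count_apply ((MeasurableSet.univ_pi hB).inter (hTfin s).measurableSet),
        Set.inter_comm, ← Set.pi_inter_distrib]
      simp_rw [Set.inter_assoc]
      refine encard_univ_pi fun i => ?_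
      exact (s.finite_inter W hWb).subset fun y hy => ⟨hy.1, hy.2.1⟩
    simp_rw [this]
    exact Finset.measurable_fun_prod _ fun i _ => measurable_encard_inter (hW.inter (hB i))
  have hμ : Measurable μ := by
    refine .measure_of_isPiSystem generateFrom_pi.symm isPiSystem_pi ?_ ?_
    · rintro _ ⟨B, hB, rfl⟩
      exact hbox B fun i => hB i (Set.mem_univ i)
    · have := hbox (fun _ => Set.univ) fun _ => MeasurableSet.univ
      rwa [Set.pi_univ] at this
  have hsum (s : PointConfig d) : tupleSum g (s.carrier ∩ W)
      = ∫⁻ x, {x : Fin p → Euc d | Function.Injective x}.indicator g x ∂(μ s) := by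
    rw [← lintegral_indicator (hTfin s).measurableSet, lintegral_count, Set.indicator_indicator]
    refine (tsum_subtype
      {x : Fin p → Euc d | Function.Injective x ∧ ∀ i, x i ∈ s.carrier ∩ W} g).trans ?_
    refine tsum_congr fun x => ?_
    congr 1
    ext x
    simp [T, and_comm]
  simp_rw [hsum]
  exact (Measure.measurable_lintegral (hg.indicator measurableSet_injective)).comp hμ

/-! ### The variance bound from a covariance. -/

open ProbabilityTheory in
-- The polynomial `t ↦ Var(X - tY)` is nonnegative, so its discriminant is not positive.
theorem covariance_sq_le {Ω : Type*} [MeasurableSpace Ω] {P : Measure Ω} [IsProbabilityMeasure P]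
    {X Y : Ω → ℝ} (hX : MemLp X 2 P) (hY : MemLp Y 2 P) :
    covariance X Y P ^ 2 ≤ variance X P * variance Y P := by
  have h (t : ℝ) : 0 ≤ variance Y P * (t * t) + (-2 * covariance X Y P) * t + variance X P := by
    have h1 := variance_nonneg (fun ω => X ω - t * Y ω) P
    rw [variance_fun_sub hX (hY.const_mul t), variance_const_mul, covariance_const_mul_right] at h1
    linarith
  have := discrim_le_zero h
  rw [discrim] at this
  linarith

/-- A lower bound for the variance of `Φ` from its covariance with a variable `N` whose variance is
at most its mean. -/
theorem sq_mul_sq_le_evariance_mul {Ω : Type*} [MeasurableSpace Ω] {P : Measure Ω}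
    [IsProbabilityMeasure P] {Φ N : Ω → ℝ} (hΦ : Measurable Φ) (hN : Measurable N)
    (hΦ0 : ∀ ω, 0 ≤ Φ ω) (hN0 : ∀ ω, 0 ≤ N ω) {a m Q : ℝ≥0∞}
    (ha : ∫⁻ ω, ENNReal.ofReal (Φ ω) ∂P = a) (hm : ∫⁻ ω, ENNReal.ofReal (N ω) ∂P = m)
    (hmQ : m ≤ Q) (hQ0 : Q ≠ 0) (hQ : Q ≠ ∞)
    (hN2 : ∫⁻ ω, ENNReal.ofReal (N ω) * ENNReal.ofReal (N ω) ∂P ≤ m + m * m)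
    {u v : ℝ} (hv : 0 ≤ v) (huv : v ≤ u)
    (hcov : a * m + ENNReal.ofReal u * a
      ≤ (∫⁻ ω, ENNReal.ofReal (Φ ω) * ENNReal.ofReal (N ω) ∂P) + ENNReal.ofReal v * a) :
    ENNReal.ofReal (u - v) ^ 2 * a ^ 2 ≤ ProbabilityTheory.evariance Φ P * Q := by
  -- Without square integrability the variance is `∞`, and `Q ≠ 0` keeps the product infinite.
  by_cases hL : MemLp Φ 2 P
  swap
  · rw [ProbabilityTheory.evariance_eq_top hΦ.aestronglyMeasurable hL, ENNReal.top_mul hQ0]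
    exact le_top
  have hmtop : m ≠ ∞ := ne_top_of_le_ne_top hQ hmQ
  have hNL : MemLp N 2 P := by
    rw [memLp_two_iff_integrable_sq hN.aestronglyMeasurable]
    refine ⟨(hN.pow_const 2).aestronglyMeasurable, ?_⟩
    rw [hasFiniteIntegral_iff_ofReal (.of_forall fun ω => sq_nonneg _)]
    simp_rw [pow_two, ENNReal.ofReal_mul (hN0 _)]
    exact hN2.trans_lt (ENNReal.add_lt_top.2 ⟨hmtop.lt_top, ENNReal.mul_lt_top hmtop.lt_top hmtop.lt_top⟩)
  have hΦi : Integrable Φ P := hL.integrable one_le_two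
  have hNi : Integrable N P := hNL.integrable one_le_two
  have hΦNi : Integrable (Φ * N) P := hL.integrable_mul hNL
  have hNNi : Integrable (N * N) P := hNL.integrable_mul hNL
  have ea : a = ENNReal.ofReal (∫ ω, Φ ω ∂P) := by
    rw [← ha, ofReal_integral_eq_lintegral_ofReal hΦi (.of_forall hΦ0)]
  have em : m = ENNReal.ofReal (∫ ω, N ω ∂P) := by
    rw [← hm, ofReal_integral_eq_lintegral_ofReal hNi (.of_forall hN0)]
  have eΦN : ∫⁻ ω, ENNReal.ofReal (Φ ω) * ENNReal.ofReal (N ω) ∂P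
      = ENNReal.ofReal (∫ ω, (Φ * N) ω ∂P) := by
    rw [ofReal_integral_eq_lintegral_ofReal hΦNi
      (.of_forall fun ω => mul_nonneg (hΦ0 ω) (hN0 ω))]
    simp_rw [← ENNReal.ofReal_mul (hΦ0 _)]
    rfl
  have eNN : ∫⁻ ω, ENNReal.ofReal (N ω) * ENNReal.ofReal (N ω) ∂P
      = ENNReal.ofReal (∫ ω, (N * N) ω ∂P) := by
    rw [ofReal_integral_eq_lintegral_ofReal hNNi
      (.of_forall fun ω => mul_nonneg (hN0 ω) (hN0 ω))]
    simp_rw [← ENNReal.ofReal_mul (hN0 _)]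
    rfl
  have hA : 0 ≤ ∫ ω, Φ ω ∂P := integral_nonneg hΦ0
  have hB : 0 ≤ ∫ ω, N ω ∂P := integral_nonneg hN0
  have hAB : 0 ≤ ∫ ω, (Φ * N) ω ∂P := integral_nonneg fun ω => mul_nonneg (hΦ0 ω) (hN0 ω)
  -- All moments are now finite, so the additive inequalities in `[0, ∞]` become real ones in which
  -- subtraction is allowed.
  rw [eΦN, ea, em, ← ENNReal.ofReal_mul hA, ← ENNReal.ofReal_mul (hv.trans huv),
    ← ENNReal.ofReal_mul hv, ← ENNReal.ofReal_add (by positivity)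
      (mul_nonneg (hv.trans huv) hA), ← ENNReal.ofReal_add hAB (by positivity),
    ENNReal.ofReal_le_ofReal_iff (by positivity)] at hcov
  rw [eNN, em, ← ENNReal.ofReal_mul hB, ← ENNReal.ofReal_add hB (by positivity),
    ENNReal.ofReal_le_ofReal_iff (by positivity)] at hN2
  have hc := ProbabilityTheory.covariance_eq_sub hL hNL
  have hvN : ProbabilityTheory.variance N P ≤ ∫ ω, N ω ∂P := by
    rw [← ProbabilityTheory.covariance_self hN.aemeasurable,
      ProbabilityTheory.covariance_eq_sub hNL hNL]
    linarith
  have hcs := covariance_sq_le hL hNL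
  have hlow : (u - v) * ∫ ω, Φ ω ∂P ≤ ProbabilityTheory.covariance Φ N P := by
    rw [hc]
    linarith
  have hmain : (u - v) ^ 2 * (∫ ω, Φ ω ∂P) ^ 2
      ≤ ProbabilityTheory.variance Φ P * ∫ ω, N ω ∂P := by
    rw [← mul_pow]
    have h0 : 0 ≤ (u - v) * ∫ ω, Φ ω ∂P := mul_nonneg (sub_nonneg.2 huv) hA
    calc _ ≤ ProbabilityTheory.covariance Φ N P ^ 2 := by gcongr
      _ ≤ _ := hcs
      _ ≤ _ := mul_le_mul_of_nonneg_left hvN (ProbabilityTheory.variance_nonneg _ _)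
  calc ENNReal.ofReal (u - v) ^ 2 * a ^ 2
      = ENNReal.ofReal ((u - v) ^ 2 * (∫ ω, Φ ω ∂P) ^ 2) := by
        rw [ea, ENNReal.ofReal_mul (sq_nonneg _), ENNReal.ofReal_pow (sub_nonneg.2 huv),
          ENNReal.ofReal_pow hA]
    _ ≤ ENNReal.ofReal (ProbabilityTheory.variance Φ P * ∫ ω, N ω ∂P) :=
        ENNReal.ofReal_le_ofReal hmain
    _ = ProbabilityTheory.evariance Φ P * m := by
        rw [ENNReal.ofReal_mul (ProbabilityTheory.variance_nonneg _ _),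
          ProbabilityTheory.ofReal_variance hL, ← em]
    _ ≤ _ := by gcongr

/-! ### Moments of the process and the bound for a single window. -/

/-- Fubini for the first of `p + 1` coordinates. -/
theorem lintegral_univ_pi_cons {E : Type*} [MeasureSpace E] [SigmaFinite (volume : Measure E)]
    {p : ℕ} (W : Set E) {h : (Fin (p + 1) → E) → ℝ≥0∞} (hh : Measurable h) :
    ∫⁻ x in Set.univ.pi fun _ => W, h x
      = ∫⁻ x in Set.univ.pi fun _ : Fin p => W, ∫⁻ y in W, h (Fin.cons y x) := by
  simp_rw [volume_pi, Measure.restrict_pi_pi]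
  have e := (measurePreserving_piFinSuccAbove
    (fun _ : Fin (p + 1) => (volume : Measure E).restrict W) 0).symm
  rw [← e.lintegral_comp hh]
  refine (lintegral_prod_symm _ (hh.comp e.measurable).aemeasurable).trans ?_
  refine lintegral_congr fun x => lintegral_congr fun y => ?_
  simp [MeasurableEquiv.piFinSuccAbove, Fin.insertNthEquiv]

theorem lintegral_univ_pi_fin_one {E : Type*} [MeasureSpace E]
    [SigmaFinite (volume : Measure E)] (W : Set E) {h : E → ℝ≥0∞} (hh : Measurable h) :
    ∫⁻ x in Set.univ.pi fun _ : Fin 1 => W, h (x 0) = ∫⁻ y in W, h y := by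
  rw [lintegral_univ_pi_cons W (h := fun x => h (x 0)) (hh.comp (measurable_pi_apply 0)),
    volume_pi, Measure.restrict_pi_pi, Measure.pi_of_empty, lintegral_dirac]
  simp

theorem measurable_det_kernelMatrix (hKm : Measurable fun z : Euc d × Euc d => K z.1 z.2) (n : ℕ) :
    Measurable fun x : Fin n → Euc d => (kernelMatrix K x).det := by
  simp only [Matrix.det_apply]
  refine Finset.measurable_fun_sum _ fun σ _ => Measurable.const_smul ?_ _
  refine Finset.measurable_fun_prod _ fun i _ => ?_
  have h : Measurable fun x : Fin n → Euc d => (x (σ i), x i) :=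
    (measurable_pi_apply (σ i)).prodMk (measurable_pi_apply i)
  exact hKm.comp h

/-- The Campbell formula in a window. -/
theorem IsDPP.lintegral_tupleSum {Ω : Type*} [MeasurableSpace Ω] {P : Measure Ω}
    {X : Ω → PointConfig d} (hX : IsDPP P X K) {W : Set (Euc d)} (hW : MeasurableSet W) {n : ℕ}
    (hn : 1 ≤ n) {g : (Fin n → Euc d) → ℝ≥0∞} (hg : Measurable g) :
    ∫⁻ ω, tupleSum g ((X ω).carrier ∩ W) ∂P
      = ∫⁻ x in Set.univ.pi fun _ => W, g x * ENNReal.ofReal (kernelMatrix K x).det.re := by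
  obtain ⟨ρ, ⟨-, -, hρ⟩, hdet⟩ := hX.2 n hn
  have hWn : MeasurableSet (Set.univ.pi fun _ : Fin n => W) := MeasurableSet.univ_pi fun _ => hW
  simp_rw [← tupleSum_indicator]
  refine (hρ _ (hg.indicator hWn)).trans ?_
  rw [← lintegral_indicator hWn]
  refine lintegral_congr fun x => ?_
  have hρx : ρ x = (kernelMatrix K x).det.re := by rw [← hdet x, Complex.ofReal_re]
  rw [hρx]
  by_cases hx : x ∈ Set.univ.pi fun _ : Fin n => W <;> simp [hx]

/-- The determinant is `K(x,x) K(y,y) - |K(x,y)|²`. This repulsion is what gives `Var N ≤ E N`. -/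
theorem lintegral_det_kernelMatrix_two_le (hKh : ∀ x y, K y x = star (K x y))
    (hKm : Measurable fun z : Euc d × Euc d => K z.1 z.2)
    (hdiag : ∀ᵐ y, 0 ≤ (K y y).re) (W : Set (Euc d)) :
    ∫⁻ x in Set.univ.pi fun _ : Fin 2 => W, ENNReal.ofReal (kernelMatrix K x).det.re
      ≤ (∫⁻ y in W, ENNReal.ofReal (K y y).re) * ∫⁻ y in W, ENNReal.ofReal (K y y).re := by
  have hKd : Measurable fun y => ENNReal.ofReal (K y y).re :=
    (Complex.measurable_re.comp (hKm.comp (measurable_id.prodMk measurable_id))).ennreal_ofReal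
  have hdet (x y : Euc d) (hx : 0 ≤ (K x x).re) :
      ENNReal.ofReal (kernelMatrix K (Fin.cons y fun _ : Fin 1 => x : Fin 2 → Euc d)).det.re
        ≤ ENNReal.ofReal (K x x).re * ENNReal.ofReal (K y y).re := by
    rw [← ENNReal.ofReal_mul hx]
    refine ENNReal.ofReal_le_ofReal ?_
    have h1 : (K x x).im = 0 := by
      have := congrArg Complex.im (hKh x x)
      rw [Complex.star_def, Complex.conj_im] at this
      linarith
    rw [Matrix.det_fin_two]
    simp only [kernelMatrix, Matrix.of_apply, Fin.cons_zero, Fin.cons_one]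
    rw [hKh x y, Complex.star_def, mul_comm ((starRingEnd ℂ) (K x y)), Complex.mul_conj]
    simp only [Complex.sub_re, Complex.mul_re, Complex.ofReal_re, h1, mul_zero, sub_zero]
    have := Complex.normSq_nonneg (K x y)
    linarith
  have hm2 : Measurable fun x : Fin 2 → Euc d => ENNReal.ofReal (kernelMatrix K x).det.re :=
    (Complex.measurable_re.comp (measurable_det_kernelMatrix hKm 2)).ennreal_ofReal
  rw [lintegral_univ_pi_cons W hm2]
  rw [← lintegral_mul_const _ hKd, ← lintegral_univ_pi_fin_one W (hKd.mul_const _)]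
  have hx0 : ∀ᵐ x : Fin 1 → Euc d, 0 ≤ (K (x 0) (x 0)).re :=
    (Measure.quasiMeasurePreserving_eval (fun _ : Fin 1 => (volume : Measure (Euc d))) 0).ae hdiag
  refine lintegral_mono_ae ?_
  filter_upwards [ae_restrict_of_ae hx0] with x hx
  rw [← lintegral_const_mul _ hKd]
  refine lintegral_mono fun y => ?_
  convert hdet (x 0) y hx using 6
  ext i
  rw [Subsingleton.elim i 0]

/-- A lower bound for the variance of a `U`-statistic of a determinantal point process. -/
theorem IsDPP.sq_mul_sq_le_evariance_subsetSum {p : ℕ} (hp : 1 ≤ p)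
    {f : (Fin p → Euc d) → ℝ} (hf_meas : Measurable f) (hf_nonneg : ∀ x, 0 ≤ f x)
    (hf_symm : ∀ (σ : Equiv.Perm (Fin p)) (x : Fin p → Euc d), f (x ∘ σ) = f x)
    (hKh : ∀ x y, K y x = star (K x y))
    (hKm : Measurable fun z : Euc d × Euc d => K z.1 z.2)
    {M : ℝ} (hM : 0 < M) (hKM : ∀ x y, ‖K x y‖ ≤ M) {κ : ℝ} (hκ0 : 0 < κ) (hκ1 : κ < 1)
    (hκ : ∀ g : Euc d → ℂ, MemLp g 2 volume →
      eLpNorm (kernelApply volume K g) 2 volume ≤ ENNReal.ofReal κ * eLpNorm g 2 volume)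
    {Ω : Type*} [MeasurableSpace Ω] {P : Measure Ω} [IsProbabilityMeasure P]
    {X : Ω → PointConfig d} (hX : IsDPP P X K)
    {W : Set (Euc d)} (hWc : IsCompact W) (hW0 : volume W ≠ 0) :
    ENNReal.ofReal (p - κ * p) ^ 2 * (∫⁻ x in Set.univ.pi fun _ : Fin p => W,
        ENNReal.ofReal (f x * (kernelMatrix K x).det.re)) ^ 2
      ≤ ENNReal.ofReal ((p.factorial : ℝ) ^ 2) * ProbabilityTheory.evariance
          (fun ω => subsetSum f ((X ω).carrier ∩ W)) P * (ENNReal.ofReal M * volume W) := by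
  have hW : MeasurableSet W := hWc.isClosed.measurableSet
  have hWb := hWc.isBounded
  have hWfin : volume W ≠ ∞ := hWc.measure_lt_top.ne
  have hSfin (ω : Ω) : ((X ω).carrier ∩ W).Finite := (X ω).finite_inter W hWb
  have hKd : Measurable fun y => ENNReal.ofReal (K y y).re :=
    (Complex.measurable_re.comp (hKm.comp (measurable_id.prodMk measurable_id))).ennreal_ofReal
  have hdetm (n : ℕ) : Measurable fun x : Fin n → Euc d =>
      ENNReal.ofReal (kernelMatrix K x).det.re :=
    (Complex.measurable_re.comp (measurable_det_kernelMatrix hKm n)).ennreal_ofReal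
  set φ : (Fin p → Euc d) → ℝ≥0∞ := fun x => ENNReal.ofReal (f x) with hφ
  have hφm : Measurable φ := hf_meas.ennreal_ofReal
  set U : Ω → ℝ≥0∞ := fun ω => tupleSum φ ((X ω).carrier ∩ W) with hU
  set n : Ω → ℝ≥0∞ := fun ω => ((((X ω).carrier ∩ W).encard : ℕ∞) : ℝ≥0∞) with hn
  have hUm : Measurable U := (measurable_tupleSum hφm hW hWb).comp hX.1
  have hnm : Measurable n := (measurable_encard_inter hW).comp hX.1
  have hUeq (ω : Ω) : U ω
      = ENNReal.ofReal (p.factorial * subsetSum f ((X ω).carrier ∩ W)) := by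
    rw [hU, ENNReal.ofReal_mul (by positivity), ENNReal.ofReal_natCast]
    exact tupleSum_eq_factorial_mul hf_nonneg hf_symm (hSfin ω)
  have hUtop (ω : Ω) : U ω ≠ ∞ := by rw [hUeq]; exact ENNReal.ofReal_ne_top
  have hntop (ω : Ω) : n ω ≠ ∞ := by simpa [hn] using hSfin ω
  have hgood := ae_ae_posSemidef hKh hX.ae_det_nonneg p
  set a := ∫⁻ x in Set.univ.pi fun _ : Fin p => W,
    ENNReal.ofReal (f x * (kernelMatrix K x).det.re) with ha
  have haφ : a = ∫⁻ x in Set.univ.pi fun _ : Fin p => W,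
      φ x * ENNReal.ofReal (kernelMatrix K x).det.re := by
    simp_rw [ha, ENNReal.ofReal_mul (hf_nonneg _)]
    rfl
  set m := ∫⁻ y in W, ENNReal.ofReal (K y y).re with hm
  have hdiag : ∀ᵐ y, 0 ≤ (K y y).re := by
    have h1 := (volume_preserving_funUnique (Fin 1) (Euc d)).symm.quasiMeasurePreserving.ae
      (hX.ae_det_nonneg 1)
    filter_upwards [h1] with y hy
    rw [Matrix.det_fin_one] at hy
    exact (Complex.le_def.1 hy).1
  have hEU : ∫⁻ ω, U ω ∂P = a := by rw [haφ]; exact hX.lintegral_tupleSum hW hp hφm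
  have hn1 (ω : Ω) : n ω = tupleSum (fun _ : Fin 1 → Euc d => 1) ((X ω).carrier ∩ W) :=
    (tupleSum_one _).symm
  have hEn : ∫⁻ ω, n ω ∂P = m := by
    simp_rw [hn1]
    rw [hX.lintegral_tupleSum hW le_rfl measurable_const, hm, ← lintegral_univ_pi_fin_one W hKd]
    simp [kernelMatrix]
  have hEnn : ∫⁻ ω, n ω * n ω ∂P ≤ m + m * m := by
    have h1 (ω : Ω) : n ω * n ω = n ω
        + tupleSum (fun _ : Fin 2 → Euc d => 1) ((X ω).carrier ∩ W) := by
      have := tupleSum_mul_encard (fun _ : Fin 1 → Euc d => 1) ((X ω).carrier ∩ W)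
      rw [tupleSum_one, Nat.cast_one, one_mul] at this
      exact this
    simp_rw [h1]
    rw [lintegral_add_left hnm, hEn, hX.lintegral_tupleSum hW one_le_two measurable_const]
    simp_rw [one_mul]
    gcongr
    exact lintegral_det_kernelMatrix_two_le hKh hKm hdiag W
  set b := ∫⁻ x in Set.univ.pi fun _ : Fin p => W, φ x *
    ∫⁻ y in W, ENNReal.ofReal (kernelMatrix K (Fin.cons y x : Fin (p + 1) → Euc d)).det.re with hb
  have hEUn : ∫⁻ ω, U ω * n ω ∂P = p * a + b := by
    have htail : Measurable fun x : Fin (p + 1) → Euc d => φ (Fin.tail x) :=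
      hφm.comp (measurable_pi_lambda _ fun i => measurable_pi_apply _)
    have hprod : Measurable fun x : Fin (p + 1) → Euc d =>
        φ (Fin.tail x) * ENNReal.ofReal (kernelMatrix K x).det.re := htail.mul (hdetm _)
    simp_rw [hU, hn, tupleSum_mul_encard]
    rw [lintegral_add_left (hUm.const_mul _), lintegral_const_mul _ hUm, hEU,
      hX.lintegral_tupleSum hW (by lia) htail,
      lintegral_univ_pi_cons W hprod, hb]
    congr 1
    refine lintegral_congr fun x => ?_
    simp_rw [Fin.tail_cons]
    refine lintegral_const_mul _ ((hdetm (p + 1)).comp ?_)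
    exact measurable_pi_lambda _ fun i => by
      refine Fin.cases ?_ (fun i => ?_) i
      · exact measurable_id
      · exact measurable_const
  have hcov : a * m ≤ b + ENNReal.ofReal (κ * p) * a := by
    have h1 : Measurable fun x => φ x * ENNReal.ofReal (kernelMatrix K x).det.re :=
      hφm.mul (hdetm p)
    rw [haφ, ← lintegral_mul_const _ h1, ← lintegral_const_mul _ h1, hb,
      ← lintegral_add_right _ (h1.const_mul _)]
    refine lintegral_mono_ae ?_
    filter_upwards [ae_restrict_of_ae hgood] with x hx
    have h2 := det_mul_lintegral_le hKh hKm hKM hκ0 hκ hW hWfin hW0 x hx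
    calc _ = φ x * (ENNReal.ofReal (kernelMatrix K x).det.re * m) := by ring
      _ ≤ _ := mul_le_mul' le_rfl h2
      _ = _ := by ring
  have hmQ : m ≤ ENNReal.ofReal M * volume W := by
    calc m ≤ ∫⁻ _ in W, ENNReal.ofReal M := by
          refine lintegral_mono fun y => ENNReal.ofReal_le_ofReal ?_
          exact (Complex.re_le_norm _).trans (hKM y y)
      _ = _ := by simp
  have hofU (ω : Ω) : ENNReal.ofReal (U ω).toReal = U ω := ENNReal.ofReal_toReal (hUtop ω)
  have hofn (ω : Ω) : ENNReal.ofReal (n ω).toReal = n ω := ENNReal.ofReal_toReal (hntop ω)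
  -- Here `u = p` counts the entries of the tuple themselves and `v = κ p` bounds the loss from
  -- conditioning.
  have hmain := sq_mul_sq_le_evariance_mul (P := P) hUm.ennreal_toReal hnm.ennreal_toReal
    (fun _ => ENNReal.toReal_nonneg) (fun _ => ENNReal.toReal_nonneg) (a := a) (m := m)
    (Q := ENNReal.ofReal M * volume W) (u := p) (v := κ * p) (by simp_rw [hofU, hEU])
    (by simp_rw [hofn, hEn]) hmQ (mul_ne_zero (by simpa using hM) hW0)
    (ENNReal.mul_ne_top ENNReal.ofReal_ne_top hWfin) (by simp_rw [hofn]; exact hEnn)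
    (by positivity) (mul_le_of_le_one_left (by positivity) hκ1.le) (by
      simp_rw [hofU, hofn, hEUn, ENNReal.ofReal_natCast]
      calc a * m + p * a ≤ (b + ENNReal.ofReal (κ * p) * a) + p * a := by gcongr
        _ = _ := by ring)
  have hvar : ProbabilityTheory.evariance (fun ω => (U ω).toReal) P
      = ENNReal.ofReal ((p.factorial : ℝ) ^ 2) * ProbabilityTheory.evariance
          (fun ω => subsetSum f ((X ω).carrier ∩ W)) P := by
    rw [← ProbabilityTheory.evariance_mul]
    congr 1
    ext ω
    rw [hUeq, ENNReal.toReal_ofReal (mul_nonneg (by positivity) (subsetSum_nonneg hf_nonneg _))]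
  rwa [hvar] at hmain

end Kernel

theorem propositionB6 {d p : ℕ} (hp : 1 ≤ p)
    (f : (Fin p → Euc d) → ℝ) (hf_meas : Measurable f) (hf_nonneg : ∀ x, 0 ≤ f x)
    (hf_symm : ∀ (σ : Equiv.Perm (Fin p)) (x : Fin p → Euc d), f (x ∘ σ) = f x)
    (K : Euc d → Euc d → ℂ) (hK : ConditionH K)
    (hK_bdd : ∃ M : ℝ, ∀ x y, ‖K x y‖ ≤ M)
    (hK_norm : kernelOpNorm K < 1)
    {Ω : Type*} [MeasurableSpace Ω] (P : Measure Ω) [IsProbabilityMeasure P]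
    (X : Ω → PointConfig d) (hX : IsDPP P X K)
    (W : ℕ → Set (Euc d)) (hW_compact : ∀ n, IsCompact (W n)) (hW_mono : Monotone W)
    (hliminf : 0 < liminf (fun n =>
      (∫⁻ x in Set.univ.pi fun _ : Fin p => W n,
        ENNReal.ofReal (f x * (kernelMatrix K x).det.re)) / volume (W n)) atTop) :
    0 < liminf (fun n =>
      ProbabilityTheory.evariance (fun ω => subsetSum f ((X ω).carrier ∩ W n)) P
        / volume (W n)) atTop := by
  obtain ⟨κ, hκ0, hκ1, hκ⟩ := exists_eLpNorm_kernelApply_le hK_norm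
  obtain ⟨M, hM, hKM⟩ : ∃ M : ℝ, 0 < M ∧ ∀ x y, ‖K x y‖ ≤ M := by
    obtain ⟨M, hM⟩ := hK_bdd
    exact ⟨max M 1, by positivity, fun x y => (hM x y).trans (le_max_left _ _)⟩
  obtain ⟨ε, hε0, hε⟩ := exists_between hliminf
  have hev := eventually_lt_of_lt_liminf hε
  set δ := ENNReal.ofReal (p - κ * p) with hδ
  set G := ENNReal.ofReal ((p.factorial : ℝ) ^ 2) with hG
  have hδ0 : δ ≠ 0 := by
    have : (0 : ℝ) < p := by exact_mod_cast hp
    have : 0 < p - κ * p := by nlinarith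
    simpa [hδ] using this
  have hG0 : G ≠ 0 := by
    have : (0 : ℝ) < (p.factorial : ℝ) ^ 2 := by positivity
    simpa only [hG, ne_eq, ENNReal.ofReal_eq_zero, not_le] using this
  have hM0 : ENNReal.ofReal M ≠ 0 := by simpa using hM
  have hc : 0 < δ ^ 2 * ε ^ 2 / (G * ENNReal.ofReal M) :=
    ENNReal.div_pos (mul_ne_zero (pow_ne_zero _ hδ0) (pow_ne_zero _ hε0.ne'))
      (ENNReal.mul_ne_top ENNReal.ofReal_ne_top ENNReal.ofReal_ne_top)
  refine hc.trans_le (le_liminf_of_le (by isBoundedDefault) ?_)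
  filter_upwards [hev] with n hn
  have hVtop : volume (W n) ≠ ∞ := (hW_compact n).measure_lt_top.ne
  -- A null window would make the quotient `0 / 0 = 0`, which does not exceed `ε`.
  have hV0 : volume (W n) ≠ 0 := by
    intro h0
    have hpi : volume (Set.univ.pi fun _ : Fin p => W n) = 0 := by
      rw [volume_pi, Measure.pi_pi, h0, Finset.prod_const, Finset.card_univ, Fintype.card_fin,
        zero_pow (by lia)]
    rw [Measure.restrict_eq_zero.2 hpi, lintegral_zero_measure, ENNReal.zero_div] at hn
    exact not_lt_bot hn
  have hmain := hX.sq_mul_sq_le_evariance_subsetSum hp hf_meas hf_nonneg hf_symm hK.hermitian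
    hK.measurable hM hKM hκ0 hκ1 hκ (hW_compact n) hV0
  have hεV := (ENNReal.le_div_iff_mul_le (.inl hV0) (.inl hVtop)).1 hn.le
  set v := volume (W n)
  set E := ProbabilityTheory.evariance (fun ω => subsetSum f ((X ω).carrier ∩ W n)) P
  -- The squared mean is of order `v²` and the bound for `Var N` of order `v`, so one factor `v`
  -- survives cancellation.
  have h1 : δ ^ 2 * ε ^ 2 * v * v ≤ E * (G * ENNReal.ofReal M) * v := by
    calc δ ^ 2 * ε ^ 2 * v * v = δ ^ 2 * (ε * v) ^ 2 := by ring
      _ ≤ _ := by gcongr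
      _ ≤ _ := hmain
      _ = _ := by ring
  have h2 : δ ^ 2 * ε ^ 2 * v ≤ E * (G * ENNReal.ofReal M) :=
    (ENNReal.mul_le_mul_iff_left hV0 hVtop).1 h1
  rw [ENNReal.le_div_iff_mul_le (.inl hV0) (.inl hVtop), ENNReal.div_eq_inv_mul, mul_assoc,
    ← ENNReal.div_eq_inv_mul]
  exact ENNReal.div_le_of_le_mul h2
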